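/- Let $W_1$ be the Lie algebra of formal vector fields $\xi(t)\,\frac{d}{dt}$ on $\mathbb{R}$, and let $H^*(W_1)$ be its continuous cohomology with real coefficients. A $\mathcal{D}_1$-chart on a set $X$ is a map $k:U\to X$ from an open set $U\subset\mathbb{R}$; a morphism of charts $(U,k)\to(U',k')$ is an étale (smooth, with nowhere vanishing derivative) map $m:U\to U'$ with $k'\circ m=k$. A $\mathcal{D}_1$-space is a set $X$ with a set of charts $\Phi$ such that $X$ is the colimit of the charts and their morphisms, and which is maximal: closed under composition with étale maps, and containing every chart that locally belongs to $\Phi$. The point $\mathrm{pt}$ with all charts is the terminal $\mathcal{D}_1$-space; write $p_X:X\to\mathrm{pt}$. For open $U\subset\mathbb{R}$ let $S(U)$ be the space of infinite jets at $0$ of maps $f$ into $U$ regular at $0$, with coordinates $z_p=f^{(p)}(0)$, and $S''(U)=S(U)/O(1)$, with coordinates $x_0=z_0$, $x_1=\ln|z_1|$, $x_p=z_p/z_1^p$ $(p\ge 2)$. The group $\mathbb{Z}$ acts on $S''(U)$ by $x_1\mapsto x_1+n$. For a $\mathcal{D}_1$-space $X$ the de Rham complex $\Omega^*(S''(X)/\mathbb{Z})$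 consists of the families of smooth forms on the spaces $S''(U)$, one for each chart $(U,k)\in\Phi$, that are $\mathbb{Z}$-invariant and compatible with the maps $S''(U)\to S''(U')$ induced by all morphisms of charts; here a smooth form on an open subset of $\mathbb{R}^\infty$ is one that is locally the pullback of a smooth form on an open subset of some $\mathbb{R}^k$. Let $\theta$ be the $W_1$-valued Gelfand--Kazhdan form on $S(U)$, $\theta\big(\tfrac{d}{du}\big|_{0}\,j_0^\infty k_u\big)=-j_0^\infty\tfrac{d}{du}\big|_{0}(k_0^{-1}\circ k_u)$, and write $\theta=\sum_{k\ge0}\frac1{k!}\theta_k t^k\frac{d}{dt}$. Then: 1. $H^p(S''(\mathrm{pt})/\mathbb{Z})\cong H^p(W_1)$ for every $p\ge 0$, and the isomorphisms can be chosen to be induced by $\theta$: for every closed $\omega\in\Omega^p(S''(\mathrm{pt})/\mathbb{Z})$ there is a continuous cocycle $c$ of $W_1$ such that the pullback of $\omega$ to each $S(U)$ is $c(\theta,\dots,\theta)$, and the isomorphism sends $[\omega]$ to $[c]$. 2. There is a closed form $gvl\in\Omega^3(S''(\mathrm{pt})/\mathbb{Z})$ whose pullback to each $S(U)$ is $\theta_0\wedge\theta_1\wedge\theta_2$.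 The classes of $1$ and of $gvl$ are non-zero and span $H^0(S''(\mathrm{pt})/\mathbb{Z})$ and $H^3(S''(\mathrm{pt})/\mathbb{Z})$, respectively; all other groups $H^p(S''(\mathrm{pt})/\mathbb{Z})$ vanish. 3. For every $\mathcal{D}_1$-space $X$ there is a unique closed form in $\Omega^3(S''(X)/\mathbb{Z})$ whose pullback to $S(U)$, for each chart $(U,k)$ of $X$, is $\theta_0\wedge\theta_1\wedge\theta_2$, and its class in $H^3(S''(X)/\mathbb{Z})$ (the GVL class) is the image of $[gvl]$ under the homomorphism $p_X^*:H^3(S''(\mathrm{pt})/\mathbb{Z})\to H^3(S''(X)/\mathbb{Z})$. -/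

import Mathlib

open Set TopologicalSpace Topology
open scoped PowerSeries Nat

noncomputable section

namespace GVL

universe u

/-! ### Differential forms on open subsets of `ℝ^∞` -/

/-- The model space `ℝ^∞ = lim ℝ^k`, with the product topology. -/
abbrev RInf : Type := ℕ → ℝ

/-- The projection `π_k : ℝ^∞ → ℝ^k`. -/
def proj (k : ℕ) : RInf →L[ℝ] (Fin k → ℝ) :=
  ContinuousLinearMap.pi fun i => ContinuousLinearMap.proj (i : ℕ)

/-- Functions of a point of `ℝ^∞` and of `p` tangent vectors at that point. -/
abbrev PreForm (p : ℕ) : Type := RInf → (Fin p → RInf) → ℝ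

/-- `ω` is a smooth `p`-form on the open set `W ⊆ ℝ^∞`: locally it is `π_k^* η` for a smooth `p`-form
`η` on an open subset of some `ℝ^k`. Outside `W` the function `ω` is put equal to zero, so that
forms on `W` are equal exactly when they are equal as functions. -/
def IsSmoothForm (W : Opens RInf) {p : ℕ} (ω : PreForm p) : Prop :=
  (∀ x ∈ W, ∃ (k : ℕ) (A : Set (Fin k → ℝ)) (η : (Fin k → ℝ) → (Fin k → ℝ) [⋀^Fin p]→L[ℝ] ℝ),
    IsOpen A ∧ proj k x ∈ A ∧ ContDiffOn ℝ (⊤ : ℕ∞) η A ∧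
      ∀ y ∈ W, proj k y ∈ A → ∀ v, ω y v = η (proj k y) (fun a => proj k (v a))) ∧
  ∀ x ∉ W, ω x = 0

/-- The exterior derivative on `W`:
`dω(v_0, …, v_p) = ∑ (-1)^i ∂_{v_i} (ω(v_0, …, v̂_i, …, v_p))` for constant vectors `v_i`. -/
def extD (W : Opens RInf) {p : ℕ} (ω : PreForm p) : PreForm (p + 1) := fun x v =>
  open Classical in
  if x ∈ W then
    ∑ i : Fin (p + 1), (-1 : ℝ) ^ (i : ℕ) * lineDeriv ℝ (fun y => ω y (i.removeNth v)) x (v i)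
  else 0

/-- The pullback of a form by a smooth map `m`; the tangent map of `m` at `x` sends `w` to the vector
with components `∂_w m_n (x)`. -/
def pullback (m : RInf → RInf) {p : ℕ} (ω : PreForm p) : PreForm p := fun x v =>
  ω (m x) fun a n => lineDeriv ℝ (fun y => m y n) x (v a)

/-- The projection `ℝ^l → ℝ^k` for `k ≤ l`. -/
def projLE {k l : ℕ} (h : k ≤ l) : (Fin l → ℝ) →L[ℝ] (Fin k → ℝ) :=
  ContinuousLinearMap.pi fun i => ContinuousLinearMap.proj (Fin.castLE h i)

lemma projLE_proj {k l : ℕ} (h : k ≤ l) (x : RInf) : projLE h (proj l x) = proj k x := rfl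

lemma contDiffOn_comp_projLE {k l p : ℕ} (h : k ≤ l) {A : Set (Fin k → ℝ)}
    {η : (Fin k → ℝ) → (Fin k → ℝ) [⋀^Fin p]→L[ℝ] ℝ} (hη : ContDiffOn ℝ (⊤ : ℕ∞) η A) :
    ContDiffOn ℝ (⊤ : ℕ∞) (fun y => (η (projLE h y)).compContinuousLinearMap (projLE h))
      (projLE h ⁻¹' A) := by
  have h1 : ContDiffOn ℝ (⊤ : ℕ∞) (fun y => η (projLE h y)) (projLE h ⁻¹' A) :=
    hη.comp (projLE h).contDiff.contDiffOn (fun _ hx => hx)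
  exact (ContinuousAlternatingMap.compContinuousLinearMapCLM
    (𝕜 := ℝ) (F := ℝ) (ι := Fin p) (projLE h)).contDiff.comp_contDiffOn h1

lemma IsSmoothForm.zero (W : Opens RInf) (p : ℕ) : IsSmoothForm W (0 : PreForm p) :=
  ⟨fun _ _ => ⟨0, univ, 0, isOpen_univ, mem_univ _, contDiffOn_const, fun _ _ _ _ => rfl⟩,
    fun _ _ => rfl⟩

lemma IsSmoothForm.smul {W : Opens RInf} {p : ℕ} {ω : PreForm p} (a : ℝ)
    (hω : IsSmoothForm W ω) : IsSmoothForm W (a • ω) := by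
  refine ⟨fun x hx => ?_, fun x hx => by simp [hω.2 x hx]⟩
  obtain ⟨k, A, η, hA, hxA, hη, h⟩ := hω.1 x hx
  refine ⟨k, A, a • η, hA, hxA, hη.const_smul a, fun y hy hyA v => ?_⟩
  simp [h y hy hyA v]

lemma IsSmoothForm.add {W : Opens RInf} {p : ℕ} {ω ω' : PreForm p}
    (hω : IsSmoothForm W ω) (hω' : IsSmoothForm W ω') : IsSmoothForm W (ω + ω') := by
  refine ⟨fun x hx => ?_, fun x hx => by simp [hω.2 x hx, hω'.2 x hx]⟩
  obtain ⟨k, A, η, hA, hxA, hη, h⟩ := hω.1 x hx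
  obtain ⟨k', A', η', hA', hxA', hη', h'⟩ := hω'.1 x hx
  have hk : k ≤ max k k' := le_max_left _ _
  have hk' : k' ≤ max k k' := le_max_right _ _
  refine ⟨max k k', projLE hk ⁻¹' A ∩ projLE hk' ⁻¹' A',
    fun y => (η (projLE hk y)).compContinuousLinearMap (projLE hk) +
      (η' (projLE hk' y)).compContinuousLinearMap (projLE hk'),
    (hA.preimage (projLE hk).continuous).inter (hA'.preimage (projLE hk').continuous),
    ⟨hxA, hxA'⟩,
    ((contDiffOn_comp_projLE hk hη).mono inter_subset_left).add
      ((contDiffOn_comp_projLE hk' hη').mono inter_subset_right), ?_⟩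
  rintro y hy ⟨hyA, hyA'⟩ v
  have e1 := h y hy hyA v
  have e2 := h' y hy hyA' v
  simp only [Pi.add_apply, e1, e2]
  rfl

lemma IsSmoothForm.lineDifferentiableAt {W : Opens RInf} {p : ℕ} {ω : PreForm p}
    (hω : IsSmoothForm W ω) {x : RInf} (hx : x ∈ W) (w : Fin p → RInf) (v : RInf) :
    LineDifferentiableAt ℝ (fun y => ω y w) x v := by
  obtain ⟨k, A, η, hA, hxA, hη, h⟩ := hω.1 x hx
  have hc : Continuous fun t : ℝ => x + t • v := by fun_prop
  have h0 : x + (0 : ℝ) • v = x := by simp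
  have hev : (fun t : ℝ => ω (x + t • v) w) =ᶠ[𝓝 0]
      fun t => η (proj k x + t • proj k v) (fun a => proj k (w a)) := by
    have hW : ∀ᶠ t : ℝ in 𝓝 0, x + t • v ∈ W :=
      hc.continuousAt.eventually_mem (by rw [h0]; exact W.isOpen.mem_nhds hx)
    have hA' : ∀ᶠ t : ℝ in 𝓝 0, x + t • v ∈ proj k ⁻¹' A :=
      hc.continuousAt.eventually_mem
        (by rw [h0]; exact (hA.preimage (proj k).continuous).mem_nhds hxA)
    filter_upwards [hW, hA'] with t h1 h2
    rw [h _ h1 h2 w]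
    simp
  have hd : DifferentiableAt ℝ η (proj k x) :=
    (hη.contDiffAt (hA.mem_nhds hxA)).differentiableAt (by simp)
  have hl : DifferentiableAt ℝ (fun t : ℝ => proj k x + t • proj k v) 0 := by fun_prop
  have hd' : DifferentiableAt ℝ (fun t : ℝ => η (proj k x + t • proj k v)) 0 :=
    DifferentiableAt.comp (g := η) (0 : ℝ) (by simpa using hd) hl
  have hd2 : DifferentiableAt ℝ
      (fun t : ℝ => η (proj k x + t • proj k v) (fun a => proj k (w a))) 0 :=
    ((ContinuousAlternatingMap.apply ℝ (Fin k → ℝ) ℝ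
      (fun a => proj k (w a))).differentiableAt).comp (0 : ℝ) hd'
  exact hd2.congr_of_eventuallyEq hev

lemma extD_add {W : Opens RInf} {p : ℕ} {ω ω' : PreForm p}
    (hω : IsSmoothForm W ω) (hω' : IsSmoothForm W ω') :
    extD W (ω + ω') = extD W ω + extD W ω' := by
  funext x v
  simp only [extD, Pi.add_apply]
  split_ifs with hx
  · rw [← Finset.sum_add_distrib]
    refine Finset.sum_congr rfl fun i _ => ?_
    rw [← mul_add]
    congr 1
    exact deriv_add (hω.lineDifferentiableAt hx _ _) (hω'.lineDifferentiableAt hx _ _)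
  · simp

lemma extD_smul {W : Opens RInf} {p : ℕ} (a : ℝ) (ω : PreForm p) :
    extD W (a • ω) = a • extD W ω := by
  funext x v
  simp only [extD, Pi.smul_apply]
  split_ifs with hx
  · rw [Finset.smul_sum]
    refine Finset.sum_congr rfl fun i _ => ?_
    have : lineDeriv ℝ (fun y => a • ω y (i.removeNth v)) x (v i) =
        a • lineDeriv ℝ (fun y => ω y (i.removeNth v)) x (v i) := by
      simp only [lineDeriv, smul_eq_mul, deriv_const_mul_field']
    rw [this]
    simp only [smul_eq_mul]
    ring
  · simp

lemma extD_zero (W : Opens RInf) (p : ℕ) : extD W (0 : PreForm p) = 0 := by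
  have := extD_smul (W := W) (0 : ℝ) (0 : PreForm p)
  simpa using this

/-! ### `𝒟_∞`-spaces and their de Rham cohomology -/

/-- A `𝒟_∞`-space presented by a diagram: charts (open subsets of `ℝ^∞`) and, for each pair of
charts, a set of transition maps from the first chart to the second (each map matters only on
the domain of its source). The space is the colimit of the diagram. -/
structure ChartSystem where
  Chart : Type u
  dom : Chart → Opens RInf
  Mor : Chart → Chart → Set (RInf → RInf)

namespace ChartSystem

variable (D : ChartSystem.{u})

/-- `Ω^p(D)`, the limit of `Ω^p` over the diagram: the families of smooth forms on the charts
that are compatible with all transition maps. -/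
def forms (p : ℕ) : Submodule ℝ (D.Chart → PreForm p) where
  carrier := {ω | (∀ c, IsSmoothForm (D.dom c) (ω c)) ∧
    ∀ c c', ∀ m ∈ D.Mor c c', ∀ x ∈ D.dom c, pullback m (ω c') x = ω c x}
  zero_mem' := ⟨fun _ => IsSmoothForm.zero _ _, fun _ _ _ _ _ _ => rfl⟩
  add_mem' := by
    rintro a b ⟨ha, ha'⟩ ⟨hb, hb'⟩
    refine ⟨fun c => (ha c).add (hb c), fun c c' m hm x hx => ?_⟩
    have e1 := ha' c c' m hm x hx
    have e2 := hb' c c' m hm x hx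
    change pullback m (a c') x + pullback m (b c') x = a c x + b c x
    rw [e1, e2]
  smul_mem' := by
    rintro r a ⟨ha, ha'⟩
    refine ⟨fun c => (ha c).smul r, fun c c' m hm x hx => ?_⟩
    have e1 := ha' c c' m hm x hx
    change r • pullback m (a c') x = r • a c x
    rw [e1]

/-- The closed `p`-forms. -/
def closedForms (p : ℕ) : Submodule ℝ (D.Chart → PreForm p) where
  carrier := {ω | ω ∈ D.forms p ∧ ∀ c, extD (D.dom c) (ω c) = 0}
  zero_mem' := ⟨zero_mem _, fun c => extD_zero _ _⟩
  add_mem' := by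
    rintro a b ⟨ha, ha'⟩ ⟨hb, hb'⟩
    refine ⟨add_mem ha hb, fun c => ?_⟩
    have := extD_add (ha.1 c) (hb.1 c)
    rw [ha' c, hb' c, add_zero] at this
    exact this
  smul_mem' := by
    rintro r a ⟨ha, ha'⟩
    refine ⟨Submodule.smul_mem _ r ha, fun c => ?_⟩
    have := extD_smul (W := D.dom c) r (a c)
    rw [ha' c, smul_zero] at this
    exact this

/-- The exact `p`-forms: the differentials of elements of `Ω^{p-1}(D)`. -/
def exactForms : (p : ℕ) → Submodule ℝ (D.Chart → PreForm p)
  | 0 => ⊥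
  | p + 1 =>
    { carrier := {ω | ∃ η ∈ D.forms p, ∀ c, ω c = extD (D.dom c) (η c)}
      zero_mem' := ⟨0, zero_mem _, fun c => (extD_zero _ _).symm⟩
      add_mem' := by
        rintro a b ⟨α, hα, ha⟩ ⟨β, hβ, hb⟩
        refine ⟨α + β, add_mem hα hβ, fun c => ?_⟩
        rw [Pi.add_apply, ha c, hb c]
        exact (extD_add (hα.1 c) (hβ.1 c)).symm
      smul_mem' := by
        rintro r a ⟨α, hα, ha⟩
        refine ⟨r • α, Submodule.smul_mem _ r hα, fun c => ?_⟩
        rw [Pi.smul_apply, ha c]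
        exact (extD_smul r (α c)).symm }

/-- The de Rham cohomology `H^p(D)`. -/
abbrev H (p : ℕ) : Type u := D.closedForms p ⧸ (D.exactForms p).submoduleOf (D.closedForms p)

/-- The cohomology class of a closed form. -/
def cls {p : ℕ} (ω : D.closedForms p) : D.H p := Submodule.Quotient.mk ω

/-- The quotient `D/ℤ` by the action of `ℤ` on all charts by `x_1 ↦ x_1 + n`: the same charts,
with the translations as additional transition maps. -/
def modZ : ChartSystem.{u} where
  Chart := D.Chart
  dom := D.dom
  Mor c c' := {m | m ∈ D.Mor c c' ∨
    (c = c' ∧ ∃ n : ℤ, m = fun x : RInf => Function.update x 1 (x 1 + n))}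

end ChartSystem

/-! ### `𝒟_1`-spaces -/

/-- `m` is an étale (regular) map from `U` to `V`. Only its values on `U` matter. -/
def IsEtale (m : ℝ → ℝ) (U V : Opens ℝ) : Prop :=
  ContDiffOn ℝ (⊤ : ℕ∞) m U ∧ (∀ x ∈ U, deriv m x ≠ 0) ∧ ∀ x ∈ U, m x ∈ V

/-- A `𝒟_1`-chart on the set `X`. -/
structure Chart (X : Type u) where
  U : Opens ℝ
  k : U → X

/-- Morphisms of charts: étale maps `m : U → U'` with `k' ∘ m = k`. -/
def Chart.IsMor {X : Type u} (c c' : Chart X) (m : ℝ → ℝ) : Prop :=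
  IsEtale m c.U c'.U ∧ ∀ (x : c.U) (y : c'.U), (y : ℝ) = m x → c'.k y = c.k x

/-- The chart `f ∘ k` on `Y`. -/
def Chart.map {X : Type u} {Y : Type*} (f : X → Y) (c : Chart X) : Chart Y := ⟨c.U, f ∘ c.k⟩

/-- A `𝒟_1`-space structure on `X`: a maximal `𝒟_1`-atlas. -/
structure D1Space (X : Type u) where
  atlas : Set (Chart X)
  /-- The canonical map from the colimit of the charts to `X` is onto. -/
  surj : ∀ x : X, ∃ c ∈ atlas, x ∈ range c.k
  /-- The canonical map from the colimit of the charts to `X` is injective: points of charts with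
  the same image are identified by the equivalence relation generated by morphisms of charts. -/
  inj : ∀ a b : (Σ c : atlas, c.1.U), a.1.1.k a.2 = b.1.1.k b.2 →
    Relation.EqvGen
      (fun a b : (Σ c : atlas, c.1.U) => ∃ m, a.1.1.IsMor b.1.1 m ∧ m a.2 = b.2) a b
  /-- Maximality, first condition: closure under composition with étale maps. -/
  comp_mem : ∀ c ∈ atlas, ∀ (U : Opens ℝ) (m : ℝ → ℝ) (hm : IsEtale m U c.U),
    (⟨U, fun x => c.k ⟨m x, hm.2.2 x x.2⟩⟩ : Chart X) ∈ atlas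
  /-- Maximality, second condition: a map that is locally a chart is a chart. -/
  local_mem : ∀ c : Chart X,
    (∀ x ∈ c.U, ∃ (V : Opens ℝ) (hV : V ≤ c.U), x ∈ V ∧
      (⟨V, fun y => c.k ⟨y, hV y.2⟩⟩ : Chart X) ∈ atlas) → c ∈ atlas

/-- The point `pt` as a `𝒟_1`-space: all charts. -/
def pt : D1Space Unit where
  atlas := univ
  surj := fun _ => ⟨⟨⊤, fun _ => ()⟩, mem_univ _, ⟨⟨0, trivial⟩, rfl⟩⟩
  inj := by
    rintro ⟨⟨⟨U, k⟩, hc⟩, x, hx⟩ ⟨⟨⟨V, l⟩, hd⟩, y, hy⟩ -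
    change x ∈ U at hx
    change y ∈ V at hy
    let W : Opens ℝ := ⟨U ∩ (fun t => t + (y - x)) ⁻¹' V,
      U.isOpen.inter (V.isOpen.preimage (by fun_prop))⟩
    have hxW : x ∈ W := ⟨hx, by simpa using hy⟩
    let e : Chart Unit := ⟨W, fun _ => ()⟩
    let z : (Σ c : (univ : Set (Chart Unit)), c.1.U) := ⟨⟨e, mem_univ _⟩, ⟨x, hxW⟩⟩
    refine Relation.EqvGen.trans _ z _ (Relation.EqvGen.symm _ _ (Relation.EqvGen.rel _ _ ?_))
      (Relation.EqvGen.rel _ _ ?_)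
    · exact ⟨id, ⟨⟨contDiff_id.contDiffOn, fun t _ => by simp, fun t ht => ht.1⟩,
        fun _ _ _ => rfl⟩, rfl⟩
    · refine ⟨fun t => t + (y - x), ⟨⟨by fun_prop, fun t _ => by simp, fun t ht => ht.2⟩,
        fun _ _ _ => rfl⟩, ?_⟩
      change x + (y - x) = y
      ring
  comp_mem := fun _ _ _ _ _ => mem_univ _
  local_mem := fun _ _ => mem_univ _

/-! ### Frames of infinite order -/

/-- The frames of infinite order `S(U)`, in the coordinates `z_p = f^{(p)}(0)` of the jet at `0` of
a map `f` into `U` that is regular at `0`. -/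
def frames (U : Opens ℝ) : Set RInf := {z | z 0 ∈ U ∧ z 1 ≠ 0}

/-- The polynomial map `f(t) = ∑_{p ≤ n} z_p t^p / p!` with the `n`-jet `(z_0, …, z_n)` at `0`. -/
def jetPoly (z : RInf) (n : ℕ) (t : ℝ) : ℝ := ∑ p ∈ Finset.range (n + 1), z p * t ^ p / (p ! : ℝ)

/-- The map `S(U) → S(V)` induced by an étale map `h : U → V`, i.e. `j f ↦ j (h ∘ f)`; the `n`-th
derivative of `h ∘ f` at `0` depends only on the `n`-jet of `f`. -/
def lift (h : ℝ → ℝ) (z : RInf) : RInf := fun n => iteratedDeriv n (h ∘ jetPoly z n) 0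

/-- The projection `S(U) → S''(U) = S(U)/O(1)`, where `±1` acts by `z_p ↦ (±1)^p z_p`, in the
coordinates `x_0 = z_0`, `x_1 = ln |z_1|`, `x_p = z_p / z_1^p` (`p ≥ 2`) on `S''(U)`. -/
def toS'' (z : RInf) : RInf
  | 0 => z 0
  | 1 => Real.log |z 1|
  | n + 2 => z (n + 2) / z 1 ^ (n + 2)

/-- The section of `S(U) → S''(U)` with values in the frames with `z_1 > 0`. -/
def ofS'' (x : RInf) : RInf
  | 0 => x 0
  | 1 => Real.exp (x 1)
  | n + 2 => x (n + 2) * Real.exp (x 1) ^ (n + 2)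

/-- The map `S''(U) → S''(V)` induced by an étale map `h : U → V`. -/
def lift'' (h : ℝ → ℝ) (x : RInf) : RInf := toS'' (lift h (ofS'' x))

/-- The coordinate domain of `S''(U)`. -/
def domS'' (U : Opens ℝ) : Opens RInf := ⟨{x | x 0 ∈ U}, U.isOpen.preimage (continuous_apply 0)⟩

/-- The `𝒟_∞`-space `S''(X)` of a `𝒟_1`-space `X`. -/
def S'' {X : Type u} (A : D1Space X) : ChartSystem.{u} where
  Chart := A.atlas
  dom c := domS'' c.1.U
  Mor c c' := {M | ∃ m, c.1.IsMor c'.1 m ∧ M = lift'' m}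

/-- The `𝒟_∞`-space `S''(X)/ℤ`. -/
abbrev S''modZ {X : Type u} (A : D1Space X) : ChartSystem.{u} := (S'' A).modZ

/-- The pullback of families of forms along the unique morphism `p_X : X → pt`. -/
def pullPt {X : Type u} (A : D1Space X) (p : ℕ) :
    ((S''modZ pt).Chart → PreForm p) →ₗ[ℝ] ((S''modZ A).Chart → PreForm p) where
  toFun ω c := ω ⟨c.1.map (fun _ => ()), mem_univ _⟩
  map_add' _ _ := rfl
  map_smul' _ _ := rfl

lemma pullPt_forms {X : Type u} (A : D1Space X) {p : ℕ} {ω : (S''modZ pt).Chart → PreForm p}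
    (hω : ω ∈ (S''modZ pt).forms p) : pullPt A p ω ∈ (S''modZ A).forms p := by
  refine ⟨fun c => hω.1 ⟨c.1.map (fun _ => ()), mem_univ _⟩,
    fun c c' m hm x hx => hω.2 ⟨c.1.map (fun _ => ()), mem_univ _⟩
      ⟨c'.1.map (fun _ => ()), mem_univ _⟩ m ?_ x hx⟩
  rcases hm with ⟨h, hh, rfl⟩ | ⟨rfl, n, rfl⟩
  · exact Or.inl ⟨h, ⟨hh.1, fun _ _ _ => rfl⟩, rfl⟩
  · exact Or.inr ⟨rfl, n, rfl⟩

lemma pullPt_closed {X : Type u} (A : D1Space X) {p : ℕ} {ω : (S''modZ pt).Chart → PreForm p}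
    (hω : ω ∈ (S''modZ pt).closedForms p) : pullPt A p ω ∈ (S''modZ A).closedForms p :=
  ⟨pullPt_forms A hω.1, fun c => hω.2 ⟨c.1.map (fun _ => ()), mem_univ _⟩⟩

lemma pullPt_exact {X : Type u} (A : D1Space X) {p : ℕ} {ω : (S''modZ pt).Chart → PreForm p}
    (hω : ω ∈ (S''modZ pt).exactForms p) : pullPt A p ω ∈ (S''modZ A).exactForms p := by
  cases p with
  | zero =>
    have : ω = 0 := hω
    rw [this, map_zero]
    exact zero_mem _
  | succ p =>
    obtain ⟨η, hη, h⟩ := hω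
    exact ⟨pullPt A p η, pullPt_forms A hη, fun c => h ⟨c.1.map (fun _ => ()), mem_univ _⟩⟩

/-- The homomorphism `H^p(S''(pt)/ℤ) → H^p(S''(X)/ℤ)` induced by `p_X : X → pt`. -/
def charHom {X : Type u} (A : D1Space X) (p : ℕ) :
    (S''modZ pt).H p →ₗ[ℝ] (S''modZ A).H p :=
  Submodule.mapQ _ _ ((pullPt A p).restrict fun _ h => pullPt_closed A h)
    (fun _ h => pullPt_exact A h)

/-! ### The Lie algebra `W_1` of formal vector fields and its continuous cohomology -/

/-- Formal vector fields `ξ(t) d/dt` on the line. -/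
def W1 : Type := ℝ⟦X⟧

instance : AddCommGroup W1 := inferInstanceAs (AddCommGroup ℝ⟦X⟧)
instance : Module ℝ W1 := inferInstanceAs (Module ℝ ℝ⟦X⟧)

/-- The topology of convergence of every coefficient. -/
instance : TopologicalSpace W1 := PowerSeries.WithPiTopology.instTopologicalSpace ℝ

/-- The coefficient series `ξ(t)` of `ξ(t) d/dt`. -/
def W1.series : W1 →ₗ[ℝ] ℝ⟦X⟧ := LinearMap.id

/-- `[ξ d/dt, η d/dt] = (ξ η' - η ξ') d/dt`. -/
instance : Bracket W1 W1 :=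
  ⟨fun ξ η => (ξ.series * d⁄dX ℝ η.series - η.series * d⁄dX ℝ ξ.series : ℝ⟦X⟧)⟩

lemma W1.series_lie (ξ η : W1) :
    W1.series ⁅ξ, η⁆ = ξ.series * d⁄dX ℝ η.series - η.series * d⁄dX ℝ ξ.series := rfl

lemma W1.series_injective : Function.Injective W1.series := fun _ _ h => h

instance : LieRing W1 where
  add_lie ξ η ζ := W1.series_injective (by simp only [W1.series_lie, map_add]; ring)
  lie_add ξ η ζ := W1.series_injective (by simp only [W1.series_lie, map_add]; ring)
  lie_self ξ := W1.series_injective (by simp only [W1.series_lie, map_zero]; ring)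
  leibniz_lie ξ η ζ := W1.series_injective (by
    simp only [W1.series_lie, map_add, map_sub, Derivation.leibniz, smul_eq_mul]; ring)

instance : LieAlgebra ℝ W1 where
  lie_smul a ξ η := W1.series_injective (by
    simp only [W1.series_lie, map_smul, Derivation.map_smul, smul_mul_assoc, mul_smul_comm,
      smul_sub])

/-- The continuous `p`-cochains of `W_1` with values in `ℝ`: the continuous alternating multilinear
maps, regarded as functions. -/
def cochains (p : ℕ) : Submodule ℝ ((Fin p → W1) → ℝ) where
  carrier := {c | ∃ f : W1 [⋀^Fin p]→L[ℝ] ℝ, c = fun ξ => f ξ}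
  zero_mem' := ⟨0, rfl⟩
  add_mem' := by
    rintro _ _ ⟨f, rfl⟩ ⟨g, rfl⟩
    exact ⟨f + g, rfl⟩
  smul_mem' := by
    rintro r _ ⟨f, rfl⟩
    exact ⟨r • f, rfl⟩

/-- The Chevalley–Eilenberg differential of cochains with trivial coefficients,
`dc(ξ_0, …, ξ_p) = ∑_{i < l} (-1)^{i+l} c([ξ_i, ξ_l], ξ_0, …, ξ̂_i, …, ξ̂_l, …, ξ_p)`;
below `l = j + 1`. -/
def ceD : (p : ℕ) → ((Fin p → W1) → ℝ) →ₗ[ℝ] ((Fin (p + 1) → W1) → ℝ)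
  | 0 => 0
  | p + 1 =>
    { toFun := fun c ξ => ∑ i : Fin (p + 2), ∑ j : Fin (p + 1),
        if i < j.succ then
          (-1 : ℝ) ^ ((i : ℕ) + (j.succ : ℕ)) *
            c (Fin.cons ⁅ξ i, ξ j.succ⁆ (j.removeNth (i.removeNth ξ)))
        else 0
      map_add' := fun c c' => by
        funext ξ
        simp only [Pi.add_apply, ← Finset.sum_add_distrib]
        refine Finset.sum_congr rfl fun i _ => Finset.sum_congr rfl fun j _ => ?_
        split_ifs
        · rw [mul_add]
        · simp
      map_smul' := fun r c => by
        funext ξ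
        simp only [Pi.smul_apply, Finset.smul_sum, RingHom.id_apply]
        refine Finset.sum_congr rfl fun i _ => Finset.sum_congr rfl fun j _ => ?_
        split_ifs
        · simp only [smul_eq_mul]; ring
        · simp }

/-- Continuous cocycles. -/
def cocycles (p : ℕ) : Submodule ℝ ((Fin p → W1) → ℝ) := cochains p ⊓ LinearMap.ker (ceD p)

/-- The differentials of continuous cochains. -/
def coboundaries : (p : ℕ) → Submodule ℝ ((Fin p → W1) → ℝ)
  | 0 => ⊥
  | p + 1 => (cochains p).map (ceD p)

/-- The Gelfand–Fuchs cohomology `H^p(W_1)`. -/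
abbrev HW1 (p : ℕ) : Type := cocycles p ⧸ (coboundaries p).submoduleOf (cocycles p)

/-- The cohomology class of a cocycle. -/
def clsW1 {p : ℕ} (c : cocycles p) : HW1 p := Submodule.Quotient.mk c

/-! ### The Gelfand–Kazhdan form -/

/-- The Taylor series `∑ z_p t^p / p!`. -/
def taylor (z : RInf) : ℝ⟦X⟧ := PowerSeries.mk fun p => z p / (p ! : ℝ)

/-- The Gelfand–Kazhdan form `θ` at the frame `z = j k_0` on the tangent vector `v = d/du j k_u`:
`θ(v) = - j (d/du (k_0⁻¹ ∘ k_u))(0) = - (d/du k_u) / k_0'`, a formal vector field. -/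
def theta (z v : RInf) : W1 := (-(taylor v * (d⁄dX ℝ (taylor z))⁻¹) : ℝ⟦X⟧)

/-- The canonical forms `θ_k`, defined by `θ = ∑ θ_k t^k / k! d/dt`. -/
def thetaK (k : ℕ) (z v : RInf) : ℝ := (k ! : ℝ) * PowerSeries.coeff k (theta z v).series

/-- The family `g` of 3-forms is `θ_0 ∧ θ_1 ∧ θ_2`: on each chart its pullback from `S''(U)` to
`S(U)` is `θ_0 ∧ θ_1 ∧ θ_2`. -/
def IsTheta012 {X : Type u} (A : D1Space X) (g : (S''modZ A).Chart → PreForm 3) : Prop :=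
  ∀ c, ∀ z ∈ frames c.1.U, ∀ v : Fin 3 → RInf,
    pullback toS'' (g c) z v = Matrix.det (Matrix.of fun i j : Fin 3 => thetaK i z (v j))

/-- The family `f` of 0-forms is the constant function `1`. -/
def IsOne {X : Type u} (A : D1Space X) (f : (S''modZ A).Chart → PreForm 0) : Prop :=
  ∀ c, ∀ x ∈ (S''modZ A).dom c, ∀ v, f c x v = 1

end GVL

end

noncomputable section

namespace GVL

/-! ### Alternating maps in coordinates -/

section Coordinates

variable {M : Type*} [AddCommGroup M] [Module ℝ M] {p : ℕ}

/-! Both cohomologies are computed outright, by the same count of weights, and the Gelfand–Kazhdan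
form then matches the generators.

Invariant forms. A polynomial map moves any point of `S''(U)` to the base point `0` of `S''(ℝ)` up
to any prescribed finite order, and a smooth form near `0` sees only finitely many coordinates.
Hence an invariant form is determined by its value at `0` (`form_eq_zero`). The homothety by `e`
followed by `x_1 ↦ x_1 - 1` fixes `0` and multiplies the `n`-th basis vector by `e^(1-n)`
(`form_dilate`), so that value only involves `dx_I` with indices of sum `p`. Since `p` distinct
natural numbers have sum at least `p(p-1)/2`, this leaves `∅`, `{1}`, `{0,2}`, `{0,1,2}`
(`strictMono_sum_eq`). Each is realised by an invariant form `canon p`, so in degrees 0 to 3 the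
invariant forms are a line and above 3 they vanish. The only nonzero differential takes `canon 1` to
`canon 2` (`extD_canon_one`); the lines in degrees 0 and 3 survive.

Cochains of `W_1`. A continuous cochain depends on finitely many coefficients (`cochain_finite`).
Cartan's formula for the Euler field `t d/dt` makes every cocycle cohomologous to its weight-zero
part (`exists_weight_zero`), and the same four multi-indices remain. The differential takes `ε_1` to
`-2 ε_0 ∧ ε_2` (`ceD_special_one`), while `ε_0 ∧ ε_1 ∧ ε_2` is closed and not exact.

Comparison. On frames, `canon p` is a nonzero multiple of the special cochain evaluated on `θ` for
`p = 0, 2, 3` (`pullback_toS''_canon`), and there are no nonzero closed invariant forms in degree 1.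
Over a general `X` the form is pulled back from the point, and it is unique because the projection
from frames to `S''(U)` is a surjective submersion (`isTheta012_unique`). -/

/-- A strictly increasing sequence of natural numbers grows at least linearly. -/
lemma le_apply_of_strictMono {I : Fin p → ℕ} (hI : StrictMono I) (a : Fin p) : (a : ℕ) ≤ I a := by
  obtain ⟨n, hn⟩ := a
  induction n with
  | zero => simp
  | succ n ih =>
    have h1 := ih (by omega)
    have h2 : I ⟨n, by omega⟩ < I ⟨n + 1, hn⟩ := hI (by simp)
    simp only at h1 ⊢
    omega

/-- The increasing multi-indices of length `p` and sum `p`. -/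
lemma strictMono_sum_eq {I : Fin p → ℕ} (hI : StrictMono I) (hs : ∑ a, I a = p) :
    p = 0 ∨ (p = 1 ∧ ∀ a, I a = 1) ∨ (p = 2 ∧ ∀ a, I a = 2 * a) ∨ (p = 3 ∧ ∀ a, I a = a) := by
  have hle := le_apply_of_strictMono hI
  by_cases h4 : 4 ≤ p
  · exfalso
    -- The least possible sum is `0 + … + (p-1) = p(p-1)/2`, which exceeds `p` once `p ≥ 4`.
    have h1 : ∑ a : Fin p, (a : ℕ) ≤ p := (Finset.sum_le_sum fun a _ => hle a).trans_eq hs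
    rw [Fin.sum_univ_eq_sum_range (fun a => a), Finset.sum_range_id] at h1
    have h2 : p * (p - 1) / 2 * 2 = p * (p - 1) :=
      Nat.div_mul_cancel (Nat.even_mul_pred_self p).two_dvd
    have h3 : p * 3 ≤ p * (p - 1) := Nat.mul_le_mul_left _ (by omega)
    omega
  · obtain rfl | rfl | rfl | rfl : p = 0 ∨ p = 1 ∨ p = 2 ∨ p = 3 := by omega
    · exact Or.inl rfl
    · refine Or.inr (Or.inl ⟨rfl, fun a => ?_⟩)
      obtain rfl : a = 0 := Subsingleton.elim _ _
      simpa using hs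
    · refine Or.inr (Or.inr (Or.inl ⟨rfl, ?_⟩))
      have h01 : I 0 < I 1 := hI (by simp)
      simp only [Fin.sum_univ_two] at hs
      simp only [Fin.forall_fin_two, Fin.val_zero, Fin.val_one]
      omega
    · refine Or.inr (Or.inr (Or.inr ⟨rfl, ?_⟩))
      have h01 : I 0 < I 1 := hI (by simp)
      have h12 : I 1 < I 2 := hI (by decide)
      simp only [Fin.sum_univ_three] at hs
      simp only [Fin.forall_fin_succ, Fin.val_zero, Fin.succ_zero_eq_one, Fin.val_one,
        Fin.succ_one_eq_two, Fin.val_two, IsEmpty.forall_iff, and_true]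
      omega

/-- The multi-index of weight zero of length `p`, for `p ≤ 3`. -/
def specialIndex : (p : ℕ) → Fin p → ℕ
  | 1, _ => 1
  | 2, a => 2 * a
  -- Meant for `p = 0` and `p = 3`; the values for `p > 3` are a default without significance.
  | _, a => a

/-- An alternating map concentrated on multi-indices of sum `p` is determined on basis vectors by
its value at the special multi-index. -/
lemma eq_zero_of_special (f : M [⋀^Fin p]→ₗ[ℝ] ℝ) (e : ℕ → M)
    (hw : ∀ I : Fin p → ℕ, ∑ a, I a ≠ p → f (fun a => e (I a)) = 0)
    (hs : p ≤ 3 → f (fun a => e (specialIndex p a)) = 0) (I : Fin p → ℕ) :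
    f (fun a => e (I a)) = 0 := by
  by_cases hinj : Function.Injective I
  · have hmono : StrictMono (I ∘ Tuple.sort I) :=
      (Tuple.monotone_sort I).strictMono_of_injective (hinj.comp (Equiv.injective _))
    rw [f.map_congr_perm (fun a => e (I a)) (Tuple.sort I)]
    suffices h : f ((fun a => e (I a)) ∘ Tuple.sort I) = 0 by rw [h, smul_zero]
    change f (fun a => e ((I ∘ Tuple.sort I) a)) = 0
    generalize I ∘ Tuple.sort I = J at hmono
    by_cases hJ : ∑ a, J a = p
    · have := strictMono_sum_eq hmono hJ
      rcases this with rfl | ⟨rfl, h⟩ | ⟨rfl, h⟩ | ⟨rfl, h⟩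
      · rw [← hs (by omega)]
        exact congrArg f (Subsingleton.elim _ _)
      all_goals
        rw [← hs (by omega)]
        congr 1
        funext a
        rw [h a]
        rfl
    · exact hw J hJ
  · obtain ⟨a, b, hab, hne⟩ := by simpa [Function.Injective] using hinj
    exact f.map_eq_zero_of_eq _ (by simp [hab]) hne

/-- A multilinear map that depends on finitely many coordinates is determined on basis vectors. -/
lemma eq_zero_of_basis (f : MultilinearMap ℝ (fun _ : Fin p => M) ℝ) (e : ℕ → M) (co : ℕ → M →ₗ[ℝ] ℝ)
    (hco : ∀ k j, co k (e j) = if k = j then 1 else 0) (N : ℕ)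
    (hN : ∀ (v : Fin p → M) (a : Fin p), (∀ k < N, co k (v a) = 0) → f v = 0)
    (h : ∀ I : Fin p → ℕ, f (fun a => e (I a)) = 0) (v : Fin p → M) : f v = 0 := by
  -- Each vector is split into its first `N` coordinates and a remainder; after multilinear
  -- expansion every term containing a remainder vanishes by `hN`.
  have hv : v = (fun a => ∑ k ∈ Finset.range N, co k (v a) • e k) +
      fun a => v a - ∑ k ∈ Finset.range N, co k (v a) • e k := by
    funext a
    simp
  have h1 := f.map_add_univ (fun a => ∑ k ∈ Finset.range N, co k (v a) • e k)
    (fun a => v a - ∑ k ∈ Finset.range N, co k (v a) • e k)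
  rw [← hv] at h1
  refine h1.trans (Finset.sum_eq_zero fun s _ => ?_)
  by_cases hs : s = Finset.univ
  · subst hs
    rw [Finset.piecewise_univ, f.map_sum_finset]
    refine Finset.sum_eq_zero fun r _ => ?_
    rw [f.map_smul_univ (fun a => co (r a) (v a)) (fun a => e (r a))]
    rw [h r, smul_zero]
  · obtain ⟨a, ha⟩ : ∃ a, a ∉ s := by simpa [Finset.eq_univ_iff_forall] using hs
    refine hN _ a fun k hk => ?_
    rw [Finset.piecewise_eq_of_notMem _ _ _ ha]
    simp [hco, hk]

/-- The form `dx_{I_0} ∧ … ∧ dx_{I_{p-1}}` with constant coefficients. -/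
def coordForm [TopologicalSpace M] (co : ℕ → M →L[ℝ] ℝ) (I : Fin p → ℕ) : M [⋀^Fin p]→L[ℝ] ℝ :=
  { (Matrix.detRowAlternating (R := ℝ) (n := Fin p)).compLinearMap
      (LinearMap.pi fun b => (co (I b)).toLinearMap) with
    cont := by
      change Continuous fun v : Fin p → M => Matrix.det (Matrix.of fun a b => co (I b) (v a))
      fun_prop }

lemma coordForm_apply [TopologicalSpace M] (co : ℕ → M →L[ℝ] ℝ) (I : Fin p → ℕ) (v : Fin p → M) :
    coordForm co I v = Matrix.det (Matrix.of fun a b => co (I b) (v a)) := rfl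

lemma coordForm_eq_zero [TopologicalSpace M] (co : ℕ → M →L[ℝ] ℝ) (I : Fin p → ℕ)
    {v : Fin p → M} {a : Fin p} (h : ∀ b, co (I b) (v a) = 0) : coordForm co I v = 0 :=
  Matrix.det_eq_zero_of_row_eq_zero a h

/-- A nonzero term of the determinant forces `J ∘ σ = I` for some permutation `σ`, and then the two
sums agree. -/
lemma coordForm_basis [TopologicalSpace M] (co : ℕ → M →L[ℝ] ℝ) (e : ℕ → M)
    (hco : ∀ k j, co k (e j) = if k = j then 1 else 0) {I J : Fin p → ℕ}
    (h : ∑ a, J a ≠ ∑ a, I a) : coordForm co I (fun a => e (J a)) = 0 := by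
  rw [coordForm_apply, Matrix.det_apply]
  refine Finset.sum_eq_zero fun σ _ => ?_
  suffices h0 : ∏ i, (Matrix.of fun a b => co (I b) (e (J a))) (σ i) i = 0 by rw [h0, smul_zero]
  by_contra hne
  refine h ?_
  rw [← Equiv.sum_comp σ J]
  refine Finset.sum_congr rfl fun i _ => ?_
  have := (Finset.prod_ne_zero_iff.1 hne) i (Finset.mem_univ _)
  by_contra hi
  exact this (by rw [Matrix.of_apply, hco, if_neg fun h => hi h.symm])

lemma specialIndex_lt (h : p ≤ 3) (a : Fin p) : specialIndex p a < 4 := by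
  obtain rfl | rfl | rfl | rfl : p = 0 ∨ p = 1 ∨ p = 2 ∨ p = 3 := by omega
  · exact a.elim0
  all_goals fin_cases a <;> decide

lemma specialIndex_sum (h : p ≤ 3) : ∑ a, specialIndex p a = p := by
  obtain rfl | rfl | rfl | rfl : p = 0 ∨ p = 1 ∨ p = 2 ∨ p = 3 := by omega
  all_goals rfl

lemma specialIndex_injective (h : p ≤ 3) : Function.Injective (specialIndex p) := by
  obtain rfl | rfl | rfl | rfl : p = 0 ∨ p = 1 ∨ p = 2 ∨ p = 3 := by omega
  all_goals decide

lemma coordForm_special [TopologicalSpace M] (co : ℕ → M →L[ℝ] ℝ) (e : ℕ → M)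
    (hco : ∀ k j, co k (e j) = if k = j then 1 else 0) (h : p ≤ 3) :
    coordForm co (specialIndex p) (fun a => e (specialIndex p a)) = 1 := by
  rw [coordForm_apply, ← Matrix.det_one (n := Fin p)]
  congr 1
  ext a b
  rw [Matrix.of_apply, hco, Matrix.one_apply]
  simp [(specialIndex_injective h).eq_iff, eq_comm]

/-- An alternating form of weight zero is a multiple of the special coordinate form. -/
lemma eq_coordForm_special [TopologicalSpace M] (co : ℕ → M →L[ℝ] ℝ) (e : ℕ → M)
    (hco : ∀ k j, co k (e j) = if k = j then 1 else 0) (h : p ≤ 3) (f : M [⋀^Fin p]→ₗ[ℝ] ℝ)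
    (N : ℕ) (hN : ∀ (v : Fin p → M) (a : Fin p), (∀ k < N, co k (v a) = 0) → f v = 0)
    (hw : ∀ I : Fin p → ℕ, ∑ a, I a ≠ p → f (fun a => e (I a)) = 0) (v : Fin p → M) :
    f v = f (fun a => e (specialIndex p a)) * coordForm co (specialIndex p) v := by
  set A := f (fun a => e (specialIndex p a)) with hA
  let g : M [⋀^Fin p]→ₗ[ℝ] ℝ := f - A • (coordForm co (specialIndex p)).toAlternatingMap
  have hg : ∀ v, g v = f v - A * coordForm co (specialIndex p) v := fun v => rfl
  refine sub_eq_zero.1 ((hg v).symm.trans ?_)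
  -- The bound 4 is for the coordinate form, whose indices are at most 3.
  refine eq_zero_of_basis g.toMultilinearMap e (fun k => (co k).toLinearMap) hco (max N 4)
    (fun v a hv => ?_) (fun I => eq_zero_of_special g e (fun I hI => ?_) (fun _ => ?_) I) v
  · refine (hg v).trans ?_
    rw [hN v a fun k hk => hv k (lt_max_of_lt_left hk), coordForm_eq_zero (a := a), mul_zero,
      sub_zero]
    exact fun b => hv _ (lt_max_of_lt_right (specialIndex_lt h b))
  · rw [hg, hw I hI, coordForm_basis co e hco (by rwa [specialIndex_sum h]), mul_zero, sub_zero]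
  · rw [hg, coordForm_special co e hco h, ← hA, mul_one, sub_self]

/-- In degrees above three there are no alternating forms of weight zero. -/
lemma eq_zero_of_weight_zero (co : ℕ → M →ₗ[ℝ] ℝ) (e : ℕ → M)
    (hco : ∀ k j, co k (e j) = if k = j then 1 else 0) (h : ¬ p ≤ 3) (f : M [⋀^Fin p]→ₗ[ℝ] ℝ)
    (N : ℕ) (hN : ∀ (v : Fin p → M) (a : Fin p), (∀ k < N, co k (v a) = 0) → f v = 0)
    (hw : ∀ I : Fin p → ℕ, ∑ a, I a ≠ p → f (fun a => e (I a)) = 0) (v : Fin p → M) :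
    f v = 0 :=
  eq_zero_of_basis f.toMultilinearMap e co hco N hN
    (eq_zero_of_special f e hw fun h' => absurd h' h) v

end Coordinates

/-! ### Continuous cochains of `W_1` -/

/-- The coefficient `ξ_k` of `ξ = ∑ ξ_k t^k d/dt`. -/
def W1.co (k : ℕ) : W1 →L[ℝ] ℝ where
  toLinearMap := (PowerSeries.coeff k).comp W1.series
  cont := PowerSeries.WithPiTopology.continuous_coeff ℝ k

/-- The vector field `t^k d/dt`. -/
def W1.mon (k : ℕ) : W1 := (PowerSeries.monomial k (1 : ℝ) : ℝ⟦X⟧)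

lemma W1.co_apply (k : ℕ) (ξ : W1) : W1.co k ξ = PowerSeries.coeff k ξ.series := rfl

lemma W1.ext_co {ξ η : W1} (h : ∀ k, W1.co k ξ = W1.co k η) : ξ = η := PowerSeries.ext h

lemma W1.co_mon (k j : ℕ) : W1.co k (W1.mon j) = if k = j then 1 else 0 :=
  PowerSeries.coeff_monomial k j 1

lemma W1.co_zero_lie (ξ η : W1) :
    W1.co 0 ⁅ξ, η⁆ = W1.co 0 ξ * W1.co 1 η - W1.co 0 η * W1.co 1 ξ := by
  simp [W1.co_apply, W1.series_lie, PowerSeries.coeff_mul, PowerSeries.coeff_derivative,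
    -PowerSeries.coeff_zero_eq_constantCoeff]

lemma W1.co_one_lie (ξ η : W1) :
    W1.co 1 ⁅ξ, η⁆ = 2 * (W1.co 0 ξ * W1.co 2 η - W1.co 0 η * W1.co 2 ξ) := by
  simp [W1.co_apply, W1.series_lie, PowerSeries.coeff_mul, PowerSeries.coeff_derivative,
    Finset.Nat.antidiagonal_succ]
  ring

lemma W1.co_two_lie (ξ η : W1) :
    W1.co 2 ⁅ξ, η⁆ = 3 * (W1.co 0 ξ * W1.co 3 η - W1.co 0 η * W1.co 3 ξ) +
      (W1.co 1 ξ * W1.co 2 η - W1.co 1 η * W1.co 2 ξ) := by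
  simp [W1.co_apply, W1.series_lie, PowerSeries.coeff_mul, PowerSeries.coeff_derivative,
    Finset.Nat.antidiagonal_succ]
  ring

/-- The adjoint action of the Euler field `t d/dt` is diagonal. -/
lemma W1.co_euler_lie (k : ℕ) (ξ : W1) : W1.co k ⁅W1.mon 1, ξ⁆ = ((k : ℝ) - 1) * W1.co k ξ := by
  have h1 : (W1.mon 1).series = (PowerSeries.X : ℝ⟦X⟧) := PowerSeries.X_eq.symm
  rw [W1.co_apply, W1.series_lie, h1, map_sub, mul_comm ξ.series,
    PowerSeries.derivative_X, one_mul, ← W1.co_apply]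
  cases k with
  | zero => simp
  | succ k =>
    rw [PowerSeries.coeff_succ_X_mul, PowerSeries.coeff_derivative, ← W1.co_apply]
    push_cast
    ring

lemma W1.euler_lie_mon (k : ℕ) : ⁅W1.mon 1, W1.mon k⁆ = ((k : ℝ) - 1) • W1.mon k := by
  refine W1.ext_co fun j => ?_
  rw [map_smul, W1.co_euler_lie, W1.co_mon, smul_eq_mul]
  split_ifs with h
  · rw [h]
  · simp

/-- The automorphism `ξ(t) d/dt ↦ r⁻¹ ξ(r t) d/dt`. -/
def W1.dilate (r : ℝ) : W1 →L[ℝ] W1 where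
  toFun ξ := (r⁻¹ • PowerSeries.rescale r ξ.series : ℝ⟦X⟧)
  map_add' ξ η := W1.series_injective (by
    change r⁻¹ • PowerSeries.rescale r (ξ.series + η.series) = _
    rw [map_add, smul_add]; rfl)
  map_smul' a ξ := W1.ext_co fun k => by
    simp only [W1.co_apply, RingHom.id_apply, map_smul]
    change PowerSeries.coeff k (r⁻¹ • PowerSeries.rescale r (a • ξ.series)) =
      a • PowerSeries.coeff k (r⁻¹ • PowerSeries.rescale r ξ.series)
    simp only [map_smul, PowerSeries.coeff_rescale, smul_eq_mul]
    ring
  cont := by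
    refine continuous_pi fun d => ?_
    have h : ∀ k, Continuous fun ξ : W1 =>
        PowerSeries.coeff k (r⁻¹ • PowerSeries.rescale r ξ.series) := fun k => by
      simp only [map_smul, PowerSeries.coeff_rescale, smul_eq_mul]
      exact continuous_const.mul (continuous_const.mul (W1.co k).continuous)
    have hd : d = Finsupp.single () (d ()) := by ext; simp
    rw [hd]
    exact h (d ())

lemma W1.co_dilate (r : ℝ) (k : ℕ) (ξ : W1) : W1.co k (W1.dilate r ξ) = r⁻¹ * r ^ k * W1.co k ξ := by
  change PowerSeries.coeff k (r⁻¹ • PowerSeries.rescale r ξ.series) = _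
  simp only [map_smul, PowerSeries.coeff_rescale, smul_eq_mul, W1.co_apply]
  ring

lemma W1.dilate_mon (r : ℝ) (k : ℕ) : W1.dilate r (W1.mon k) = (r⁻¹ * r ^ k) • W1.mon k := by
  refine W1.ext_co fun j => ?_
  rw [W1.co_dilate, map_smul, W1.co_mon, smul_eq_mul]
  split_ifs with h
  · rw [h]
  · simp

/-- Dilation is the change of variable `t ↦ r t` on vector fields. In coefficients, the two factors
`r⁻¹` and the extra power of `r` from the derivative combine to a single `r⁻¹`. -/
lemma W1.dilate_lie {r : ℝ} (hr : r ≠ 0) (ξ η : W1) :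
    W1.dilate r ⁅ξ, η⁆ = ⁅W1.dilate r ξ, W1.dilate r η⁆ := by
  refine W1.ext_co fun k => ?_
  have h : ∀ n ζ, PowerSeries.coeff n (W1.dilate r ζ).series =
      r⁻¹ * r ^ n * PowerSeries.coeff n ζ.series := fun n ζ => W1.co_dilate r n ζ
  rw [W1.co_dilate]
  simp only [W1.co_apply, W1.series_lie, map_sub, PowerSeries.coeff_mul,
    PowerSeries.coeff_derivative, h, mul_sub, Finset.mul_sum]
  congr 1 <;>
  · refine Finset.sum_congr rfl fun x hx => ?_
    rw [← Finset.HasAntidiagonal.mem_antidiagonal.1 hx]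
    field_simp
    ring

/-- A continuous multilinear function on `W_1` depends on finitely many coefficients. -/
lemma cochain_finite {p : ℕ} (f : W1 [⋀^Fin p]→L[ℝ] ℝ) :
    ∃ N : ℕ, ∀ (v : Fin p → W1) (a : Fin p), (∀ k < N, W1.co k (v a) = 0) → f v = 0 := by
  -- All coefficients of all arguments are put into one product of lines, so that a neighbourhood of
  -- `0` constrains only a finite set `S` of them.
  let g : (Fin p × ℕ → ℝ) → Fin p → W1 := fun x a => (PowerSeries.mk fun k => x (a, k) : ℝ⟦X⟧)
  have hg : Continuous g := by
    refine continuous_pi fun a => continuous_pi fun d => ?_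
    have h : Continuous fun x : Fin p × ℕ → ℝ =>
        PowerSeries.coeff (d ()) (PowerSeries.mk fun k => x (a, k)) := by
      simp only [PowerSeries.coeff_mk]
      fun_prop
    have hd : d = Finsupp.single () (d ()) := by ext; simp
    rw [hd]
    exact h
  have hg_co : ∀ v : Fin p → W1, g (fun q => W1.co q.2 (v q.1)) = v := fun v => by
    funext a
    refine W1.ext_co fun k => ?_
    exact PowerSeries.coeff_mk _ _
  rcases isEmpty_or_nonempty (Fin p) with hp | hp
  · exact ⟨0, fun _ a => hp.elim a⟩
  have hopen : IsOpen {x | |f (g x)| < 1} :=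
    isOpen_lt ((f.cont.comp hg).abs) continuous_const
  have h0 : (0 : Fin p × ℕ → ℝ) ∈ {x | |f (g x)| < 1} := by
    have : g 0 = 0 := by
      have := hg_co 0
      simp only [Pi.zero_apply, map_zero] at this
      exact this
    change |f (g 0)| < 1
    rw [this, f.map_zero]
    simp
  obtain ⟨S, u, hu, hS⟩ := isOpen_pi_iff.1 hopen 0 h0
  refine ⟨S.sup (fun q => q.2) + 1, fun v a hva => ?_⟩
  by_contra hne
  have hδ : ∀ᶠ δ : ℝ in 𝓝 0, ∀ q ∈ S, δ * W1.co q.2 (v q.1) ∈ u q := by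
    rw [Filter.eventually_all_finset]
    intro q hq
    have hc : Continuous fun δ : ℝ => δ * W1.co q.2 (v q.1) := by fun_prop
    refine hc.continuousAt.eventually_mem ?_
    rw [zero_mul]
    exact (hu q hq).1.mem_nhds (hu q hq).2
  obtain ⟨δ, hδ, hδ0⟩ := ((hδ.filter_mono nhdsWithin_le_nhds).and
    (self_mem_nhdsWithin (a := (0 : ℝ)) (s := {0}ᶜ))).exists
  set w : Fin p → W1 := fun b => δ • v b with hw
  have hfw : f w ≠ 0 := by
    have : f w = (∏ _b : Fin p, δ) • f v := f.toMultilinearMap.map_smul_univ (fun _ => δ) v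
    rw [this]
    exact mul_ne_zero (Finset.prod_ne_zero_iff.2 fun _ _ => hδ0) hne
  -- The constrained coefficients of the `a`-th argument are zero, so it may be rescaled freely
  -- without leaving the neighbourhood; rescaling until the value is 1 contradicts `|f| < 1` there.
  have hup : f (Function.update w a ((f w)⁻¹ • w a)) = 1 := by
    rw [f.map_update_smul, Function.update_eq_self, smul_eq_mul, inv_mul_cancel₀ hfw]
  have hmem := hS (show (fun q : Fin p × ℕ =>
      W1.co q.2 (Function.update w a ((f w)⁻¹ • w a) q.1)) ∈ (S : Set _).pi u by
    rintro ⟨b, k⟩ hq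
    rcases eq_or_ne b a with rfl | hb
    · have hk : k < S.sup (fun q => q.2) + 1 :=
        Nat.lt_succ_of_le (Finset.le_sup (f := fun q : Fin p × ℕ => q.2) hq)
      simpa [hw, hva k hk] using (hu _ hq).2
    · simpa [hw, hb] using hδ _ hq)
  have hlt : |f (g fun q => W1.co q.2 (Function.update w a ((f w)⁻¹ • w a) q.1))| < 1 := hmem
  rw [hg_co, hup] at hlt
  simp at hlt

/-- Continuous cochains that agree on all the vectors `t^k d/dt` are equal. -/
lemma cochain_ext {p : ℕ} {f g : W1 [⋀^Fin p]→L[ℝ] ℝ}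
    (h : ∀ I : Fin p → ℕ, f (fun a => W1.mon (I a)) = g fun a => W1.mon (I a)) : f = g := by
  obtain ⟨N, hN⟩ := cochain_finite f
  obtain ⟨N', hN'⟩ := cochain_finite g
  refine ContinuousAlternatingMap.ext fun v => sub_eq_zero.1 ?_
  refine eq_zero_of_basis (f.toMultilinearMap - g.toMultilinearMap) W1.mon
    (fun k => (W1.co k).toLinearMap) W1.co_mon (max N N') (fun v a hv => ?_) (fun I => ?_) v
  · have e1 := hN v a fun k hk => hv k (lt_max_of_lt_left hk)
    have e2 := hN' v a fun k hk => hv k (lt_max_of_lt_right hk)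
    simp [e1, e2]
  · simp [h I]

/-! ### The Chevalley–Eilenberg differential -/

lemma ceD_succ_apply {p : ℕ} (c : (Fin (p + 1) → W1) → ℝ) (ξ : Fin (p + 2) → W1) :
    ceD (p + 1) c ξ = ∑ i : Fin (p + 2), ∑ j : Fin (p + 1),
        if i < j.succ then
          (-1 : ℝ) ^ ((i : ℕ) + (j.succ : ℕ)) *
            c (Fin.cons ⁅ξ i, ξ j.succ⁆ (j.removeNth (i.removeNth ξ)))
        else 0 := rfl

/-- The differential commutes with the action of the dilations. -/
lemma ceD_dilate {r : ℝ} (hr : r ≠ 0) {p : ℕ} (c : (Fin p → W1) → ℝ) (ξ : Fin (p + 1) → W1) :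
    ceD p (fun v => c fun a => W1.dilate r (v a)) ξ = ceD p c fun a => W1.dilate r (ξ a) := by
  cases p with
  | zero => rfl
  | succ p =>
    simp only [ceD_succ_apply]
    refine Finset.sum_congr rfl fun i _ => Finset.sum_congr rfl fun j _ => ?_
    split_ifs
    · congr 2
      funext a
      refine Fin.cases ?_ (fun b => ?_) a
      · simp [W1.dilate_lie hr]
      · simp [Fin.removeNth]
    · rfl

lemma mem_cocycles {p : ℕ} {c : (Fin p → W1) → ℝ} :
    c ∈ cocycles p ↔ c ∈ cochains p ∧ ceD p c = 0 := Iff.rfl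

lemma dilate_mem_cocycles {r : ℝ} (hr : r ≠ 0) {p : ℕ} {c : (Fin p → W1) → ℝ}
    (hc : c ∈ cocycles p) : (fun v => c fun a => W1.dilate r (v a)) ∈ cocycles p := by
  obtain ⟨⟨f, rfl⟩, hd⟩ := mem_cocycles.1 hc
  refine mem_cocycles.2 ⟨⟨f.compContinuousLinearMap (W1.dilate r), rfl⟩, ?_⟩
  funext ξ
  rw [ceD_dilate hr, hd]
  rfl

/-- Multiplication of the weight components of a cocycle by arbitrary factors. -/
lemma exists_reweight {p : ℕ} (f : W1 [⋀^Fin p]→L[ℝ] ℝ) (hf : (fun v => f v) ∈ cocycles p)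
    (g : ℕ → ℝ) : ∃ f' : W1 [⋀^Fin p]→L[ℝ] ℝ, (fun v => f' v) ∈ cocycles p ∧
      ∀ I : Fin p → ℕ, f' (fun a => W1.mon (I a)) = g (∑ a, I a) * f fun a => W1.mon (I a) := by
  obtain ⟨N, hN⟩ := cochain_finite f
  have hinj : Set.InjOn (fun s : ℕ => (2 : ℝ) ^ s) (Finset.range (p * N + 1)) :=
    fun a _ b _ h => pow_right_injective₀ (by norm_num) (by norm_num) h
  -- Dilation by `2^j` acts on weight `s` by `2^(j(s-p))`. With the factor `(2^j)^p` removing the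
  -- shift, the combination with the coefficients of `q` acts on weight `s` by `q(2^s) = g s`. Only
  -- weights up to `p * N` need interpolation: an index beyond the bound `N` already gives `0`.
  set q := Lagrange.interpolate (Finset.range (p * N + 1)) (fun s : ℕ => (2 : ℝ) ^ s) g with hq
  let f' : W1 [⋀^Fin p]→L[ℝ] ℝ := ∑ j ∈ Finset.range (q.natDegree + 1),
    (q.coeff j * ((2 : ℝ) ^ j) ^ p) • f.compContinuousLinearMap (W1.dilate ((2 : ℝ) ^ j))
  have hf' : (fun v => f' v) = ∑ j ∈ Finset.range (q.natDegree + 1),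
      (q.coeff j * ((2 : ℝ) ^ j) ^ p) • fun v => f fun a => W1.dilate ((2 : ℝ) ^ j) (v a) := by
    funext v
    simp only [f', ContinuousAlternatingMap.sum_apply, Finset.sum_apply]
    rfl
  refine ⟨f', ?_, fun I => ?_⟩
  · rw [hf']
    exact Submodule.sum_mem _ fun j _ =>
      Submodule.smul_mem _ _ (dilate_mem_cocycles (by positivity) hf)
  · rw [show f' (fun a => W1.mon (I a)) = _ from congrFun hf' fun a => W1.mon (I a)]
    simp only [Finset.sum_apply, Pi.smul_apply, W1.dilate_mon]
    have h2 : ∀ j : ℕ, f (fun a => (((2 : ℝ) ^ j)⁻¹ * ((2 : ℝ) ^ j) ^ I a) • W1.mon (I a)) =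
        (((2 : ℝ) ^ j) ^ p)⁻¹ * ((2 : ℝ) ^ (∑ a, I a)) ^ j * f fun a => W1.mon (I a) := by
      intro j
      refine (f.toMultilinearMap.map_smul_univ _ _).trans ?_
      rw [Finset.prod_mul_distrib, Finset.prod_pow_eq_pow_sum, Finset.prod_const,
        Finset.card_univ, Fintype.card_fin, inv_pow, ← pow_mul (2 : ℝ) (∑ a, I a),
        ← pow_mul (2 : ℝ) j (∑ a, I a), mul_comm j (∑ a, I a)]
      rfl
    simp only [h2]
    by_cases hI : ∀ a, I a < N
    · have hs : ∑ a, I a ∈ Finset.range (p * N + 1) := by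
        have := Finset.sum_le_card_nsmul Finset.univ I N fun a _ => (hI a).le
        simp only [Finset.card_univ, Fintype.card_fin, smul_eq_mul] at this
        exact Finset.mem_range.2 (Nat.lt_succ_of_le this)
      have h3 := Lagrange.eval_interpolate_at_node g hinj hs
      rw [← hq, Polynomial.eval_eq_sum_range] at h3
      rw [← h3, Finset.sum_mul]
      refine Finset.sum_congr rfl fun j _ => ?_
      have : ((2 : ℝ) ^ j) ^ p ≠ 0 := by positivity
      rw [smul_eq_mul]
      field_simp
    · obtain ⟨a, ha⟩ := not_forall.1 hI
      have h0 : f (fun a => W1.mon (I a)) = 0 := hN _ a fun k hk => by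
        rw [W1.co_mon, if_neg (by omega)]
      simp [h0]

/-- The interior product of a continuous cochain with a vector field. -/
def interior {p : ℕ} (e : W1) (f : W1 [⋀^Fin (p + 1)]→L[ℝ] ℝ) : W1 [⋀^Fin p]→L[ℝ] ℝ :=
  { f.toAlternatingMap.curryLeft e with
    cont := f.cont.comp (Continuous.finCons continuous_const continuous_id) }

lemma interior_apply {p : ℕ} (e : W1) (f : W1 [⋀^Fin (p + 1)]→L[ℝ] ℝ) (v : Fin p → W1) :
    interior e f v = f (Fin.cons e v) := rfl

/-- Moving `x` from the front to position `j` takes `j` transpositions. -/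
lemma map_cons_removeNth {p : ℕ} (f : W1 [⋀^Fin (p + 1)]→L[ℝ] ℝ) (x : W1) (j : Fin (p + 1))
    (v : Fin (p + 1) → W1) :
    f (Fin.cons x (j.removeNth v)) = (-1) ^ (j : ℕ) * f (Function.update v j x) := by
  have := f.toAlternatingMap.neg_one_pow_smul_map_insertNth j x (j.removeNth v)
  rw [Fin.insertNth_removeNth] at this
  exact this.symm.trans (by simp)

lemma map_cons_cons {p : ℕ} (f : W1 [⋀^Fin (p + 2)]→L[ℝ] ℝ) (x y : W1) (v : Fin p → W1) :
    f (Fin.cons x (Fin.cons y v)) = - f (Fin.cons y (Fin.cons x v)) := by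
  have := map_cons_removeNth f x 1 (Fin.cons y (Fin.cons x v))
  have h1 : Fin.removeNth 1 (Fin.cons y (Fin.cons x v) : Fin (p + 2) → W1) = Fin.cons y v := by
    funext a
    refine Fin.cases ?_ (fun b => ?_) a <;> rfl
  have h2 : Function.update (Fin.cons y (Fin.cons x v) : Fin (p + 2) → W1) 1 x =
      Fin.cons y (Fin.cons x v) := Function.update_eq_self 1 _
  rw [h1, h2] at this
  simpa using this

lemma removeNth_succ_cons {p : ℕ} (i : Fin (p + 1)) (e : W1) (v : Fin (p + 1) → W1) :
    (i.succ.removeNth (Fin.cons e v : Fin (p + 2) → W1)) = Fin.cons e (i.removeNth v) := by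
  funext a
  refine Fin.cases ?_ (fun b => ?_) a
  · rfl
  · simp [Fin.removeNth, Fin.succ_succAbove_succ]

/-- Cartan's formula `L_e = d i_e + i_e d` for a cocycle. -/
lemma lieDerivative_cocycle {p : ℕ} (e : W1) (f : W1 [⋀^Fin (p + 1)]→L[ℝ] ℝ)
    (hf : (fun v => f v) ∈ cocycles (p + 1)) (ξ : Fin (p + 1) → W1) :
    ∑ a, f (Function.update ξ a ⁅e, ξ a⁆) = - ceD p (fun v => interior e f v) ξ := by
  have h := congrFun (mem_cocycles.1 hf).2 (Fin.cons e ξ)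
  rw [ceD_succ_apply, Fin.sum_univ_succ] at h
  -- In `df(e, ξ) = 0`, the brackets with `e` are the terms `i = 0`. The exponent `j + 1` of the
  -- differential and the `j` transpositions add up to an odd number, whence the minus sign.
  have h1 : ∀ j : Fin (p + 1), (if (0 : Fin (p + 2)) < j.succ then
      (-1 : ℝ) ^ (((0 : Fin (p + 2)) : ℕ) + (j.succ : ℕ)) *
        f (Fin.cons ⁅(Fin.cons e ξ : Fin (p + 2) → W1) 0, (Fin.cons e ξ : Fin (p + 2) → W1) j.succ⁆
          (j.removeNth (Fin.removeNth 0 (Fin.cons e ξ : Fin (p + 2) → W1)))) else 0) =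
      - f (Function.update ξ j ⁅e, ξ j⁆) := by
    intro j
    rw [if_pos (Fin.succ_pos j), Fin.cons_zero, Fin.cons_succ]
    have : Fin.removeNth 0 (Fin.cons e ξ : Fin (p + 2) → W1) = ξ := rfl
    rw [this, map_cons_removeNth, ← mul_assoc, ← pow_add]
    have : ((0 : Fin (p + 2)) : ℕ) + (j.succ : ℕ) + (j : ℕ) = 2 * j + 1 := by
      simp; ring
    rw [this, pow_succ, pow_mul]
    simp
  simp only [h1] at h
  rw [Finset.sum_neg_distrib, Pi.zero_apply] at h
  -- The brackets not involving `e` give the differential of the interior product; the sign comes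
  -- from interchanging `e` with the bracket.
  suffices h2 : ∑ i : Fin (p + 1), ∑ j : Fin (p + 1), (if i.succ < j.succ then
      (-1 : ℝ) ^ ((i.succ : ℕ) + (j.succ : ℕ)) *
        f (Fin.cons ⁅(Fin.cons e ξ : Fin (p + 2) → W1) i.succ,
            (Fin.cons e ξ : Fin (p + 2) → W1) j.succ⁆
          (j.removeNth (i.succ.removeNth (Fin.cons e ξ : Fin (p + 2) → W1)))) else 0) =
      - ceD p (fun v => interior e f v) ξ by
    rw [h2] at h
    linarith
  cases p with
  | zero =>
    simp [ceD]
  | succ p =>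
    rw [ceD_succ_apply, ← Finset.sum_neg_distrib]
    refine Finset.sum_congr rfl fun i _ => ?_
    rw [Fin.sum_univ_succ, if_neg (by simp), zero_add, ← Finset.sum_neg_distrib]
    refine Finset.sum_congr rfl fun j _ => ?_
    simp only [Fin.succ_lt_succ_iff]
    split_ifs with hij
    · rw [interior_apply, Fin.cons_succ, Fin.cons_succ, removeNth_succ_cons, removeNth_succ_cons,
        map_cons_cons]
      simp only [Fin.val_succ]
      ring
    · simp

/-- Every cocycle is cohomologous to a cocycle of weight zero. -/
lemma exists_weight_zero {p : ℕ} (f : W1 [⋀^Fin p]→L[ℝ] ℝ) (hf : (fun v => f v) ∈ cocycles p) :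
    ∃ f₀ : W1 [⋀^Fin p]→L[ℝ] ℝ, (fun v => f₀ v) ∈ cocycles p ∧
      (fun v => f v) - (fun v => f₀ v) ∈ coboundaries p ∧
      ∀ I : Fin p → ℕ, ∑ a, I a ≠ p → f₀ (fun a => W1.mon (I a)) = 0 := by
  obtain ⟨f₀, h₀, hw₀⟩ := exists_reweight f hf fun s => if s = p then 1 else 0
  refine ⟨f₀, h₀, ?_, fun I hI => by rw [hw₀, if_neg hI, zero_mul]⟩
  cases p with
  | zero =>
    have : f = f₀ := cochain_ext fun I => by simp [hw₀]
    rw [this, sub_self]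
    exact zero_mem _
  | succ p =>
    -- The Euler field acts on weight `s` by `s - (p + 1)`, so `b` inverts this action away from
    -- weight zero. At `s = p + 1` the convention `0⁻¹ = 0` removes exactly the component kept in
    -- `f₀`. Since `b` is again a cocycle, Cartan's formula writes its Lie derivative as a
    -- coboundary.
    obtain ⟨b, hb, hwb⟩ := exists_reweight f hf fun s => ((s : ℝ) - (p + 1 : ℕ))⁻¹
    have hdb : (fun v => f v) - (fun v => f₀ v) = fun ξ =>
        ∑ a, b (Function.update ξ a ⁅W1.mon 1, ξ a⁆) := by
      funext ξ
      let ad : W1 →ₗ[ℝ] W1 := LieAlgebra.ad ℝ W1 (W1.mon 1)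
      let B : MultilinearMap ℝ (fun _ : Fin (p + 1) => W1) ℝ :=
        ∑ a, b.toMultilinearMap.compLinearMap (Function.update (fun _ => LinearMap.id) a ad)
      have hB : ∀ v, B v = ∑ a, b (Function.update v a ⁅W1.mon 1, v a⁆) := fun v => by
        simp only [B, sum_apply, MultilinearMap.compLinearMap_apply]
        refine Finset.sum_congr rfl fun a _ => congrArg b (funext fun i => ?_)
        rcases eq_or_ne i a with rfl | hi
        · simp [ad]
        · simp [hi]
      rw [← hB]
      obtain ⟨N, hN⟩ := cochain_finite f
      obtain ⟨N', hN'⟩ := cochain_finite f₀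
      obtain ⟨N'', hN''⟩ := cochain_finite b
      refine sub_eq_zero.1 (eq_zero_of_basis (f.toMultilinearMap - f₀.toMultilinearMap - B) W1.mon
        (fun k => (W1.co k).toLinearMap) W1.co_mon (max N (max N' N'')) (fun v a hv => ?_)
        (fun I => ?_) ξ)
      · have e1 := hN v a fun k hk => hv k (by simp [hk])
        have e2 := hN' v a fun k hk => hv k (by simp [hk])
        have e3 : B v = 0 := by
          rw [hB]
          refine Finset.sum_eq_zero fun i _ => hN'' _ a fun k hk => ?_
          have h0 : W1.co k (v a) = 0 := hv k (by simp [hk])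
          rcases eq_or_ne a i with rfl | hi
          · rw [Function.update_self, W1.co_euler_lie, h0, mul_zero]
          · rw [Function.update_of_ne hi, h0]
        simp [e1, e2, e3]
      · have hBI : B (fun a => W1.mon (I a)) =
            (((∑ a, I a : ℕ) : ℝ) - (p + 1 : ℕ)) * b fun a => W1.mon (I a) := by
          rw [hB]
          have : ∀ a, b (Function.update (fun a => W1.mon (I a)) a ⁅W1.mon 1, W1.mon (I a)⁆) =
              ((I a : ℝ) - 1) * b fun a => W1.mon (I a) := fun a => by
            rw [W1.euler_lie_mon, b.map_update_smul, smul_eq_mul]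
            congr 2
            exact Function.update_eq_self a _
          simp only [this]
          rw [← Finset.sum_mul, Finset.sum_sub_distrib]
          simp
        simp only [sub_apply, hBI, hwb]
        change f _ - f₀ _ - _ = 0
        rw [hw₀]
        split_ifs with hI
        · simp [hI]
        · have : ((∑ a, I a : ℕ) : ℝ) - (p + 1 : ℕ) ≠ 0 := sub_ne_zero.2 (by exact_mod_cast hI)
          field_simp
          ring
    refine ⟨fun v => - interior (W1.mon 1) b v, ⟨-interior (W1.mon 1) b, rfl⟩, ?_⟩
    rw [hdb]
    funext ξ
    rw [lieDerivative_cocycle _ _ hb]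
    have := (ceD p).map_neg fun v => interior (W1.mon 1) b v
    exact congrFun this ξ

/-! ### The cohomology of `W_1` -/

lemma ceD_one_apply (c : (Fin 1 → W1) → ℝ) (ξ : Fin 2 → W1) : ceD 1 c ξ = - c ![⁅ξ 0, ξ 1⁆] := by
  have h : ∀ v : Fin 0 → W1, Fin.cons ⁅ξ 0, ξ 1⁆ v = ![⁅ξ 0, ξ 1⁆] := fun v => by
    funext a
    fin_cases a
    rfl
  simp [ceD_succ_apply, h]

lemma ceD_two_apply (c : (Fin 2 → W1) → ℝ) (ξ : Fin 3 → W1) :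
    ceD 2 c ξ = - c ![⁅ξ 0, ξ 1⁆, ξ 2] + c ![⁅ξ 0, ξ 2⁆, ξ 1] - c ![⁅ξ 1, ξ 2⁆, ξ 0] := by
  have h : ∀ (x : W1) (v : Fin 1 → W1), Fin.cons x v = ![x, v 0] := fun x v => by
    funext a
    fin_cases a <;> rfl
  simp only [ceD_succ_apply, Fin.sum_univ_succ, h]
  simp [Fin.removeNth, Fin.succAbove]
  ring

lemma ceD_three_apply (c : (Fin 3 → W1) → ℝ) (ξ : Fin 4 → W1) :
    ceD 3 c ξ = - c ![⁅ξ 0, ξ 1⁆, ξ 2, ξ 3] + c ![⁅ξ 0, ξ 2⁆, ξ 1, ξ 3]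
      - c ![⁅ξ 0, ξ 3⁆, ξ 1, ξ 2] - c ![⁅ξ 1, ξ 2⁆, ξ 0, ξ 3] + c ![⁅ξ 1, ξ 3⁆, ξ 0, ξ 2]
      - c ![⁅ξ 2, ξ 3⁆, ξ 0, ξ 1] := by
  have h : ∀ (x : W1) (v : Fin 2 → W1), Fin.cons x v = ![x, v 0, v 1] := fun x v => by
    funext a
    fin_cases a <;> rfl
  simp only [ceD_succ_apply, Fin.sum_univ_succ, h]
  simp [Fin.removeNth, Fin.succAbove]
  ring

/-- The form `ε_{I_0} ∧ … ∧ ε_{I_{p-1}}`, where `ε_k(ξ) = ξ_k`, of weight zero. -/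
def W1.special (p : ℕ) : W1 [⋀^Fin p]→L[ℝ] ℝ := coordForm W1.co (specialIndex p)

lemma W1.special_apply_three (v : Fin 3 → W1) :
    W1.special 3 v = Matrix.det (Matrix.of fun a b : Fin 3 => W1.co b (v a)) := rfl

/-- The cocycle `ε_0 ∧ ε_1 ∧ ε_2`. -/
lemma special_three_mem : (fun v => W1.special 3 v) ∈ cocycles 3 := by
  refine mem_cocycles.2 ⟨⟨_, rfl⟩, ?_⟩
  funext ξ
  rw [ceD_three_apply]
  simp only [W1.special_apply_three, Matrix.det_fin_three, Matrix.of_apply, Matrix.cons_val,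
    Fin.val_zero, Fin.val_one, Fin.val_two, W1.co_zero_lie, W1.co_one_lie, W1.co_two_lie,
    Pi.zero_apply]
  ring

lemma special_zero_mem : (fun v => W1.special 0 v) ∈ cocycles 0 :=
  mem_cocycles.2 ⟨⟨_, rfl⟩, rfl⟩

lemma W1.special_mon {p : ℕ} (hp : p ≤ 3) :
    W1.special p (fun a => W1.mon (specialIndex p a)) = 1 :=
  coordForm_special W1.co W1.mon W1.co_mon hp

/-- The fields `d/dt`, `t d/dt`, `t² d/dt` span a copy of `sl_2`. On them any `db` equals
`-b(e_0,e_2) + 2 b(e_1,e_1) - b(e_2,e_0) = 0`, whereas the special cochain takes the value 1. -/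
lemma special_three_notMem : (fun v => W1.special 3 v) ∉ coboundaries 3 := by
  rintro ⟨_, ⟨b, rfl⟩, hb⟩
  have h := congrFun hb fun a => W1.mon (specialIndex 3 a)
  rw [W1.special_mon le_rfl, ceD_two_apply] at h
  have e01 : ⁅W1.mon 0, W1.mon 1⁆ = W1.mon 0 := by
    rw [← lie_skew, W1.euler_lie_mon]; simp
  have e12 : ⁅W1.mon 1, W1.mon 2⁆ = W1.mon 2 := by
    rw [W1.euler_lie_mon]; norm_num
  have e02 : ⁅W1.mon 0, W1.mon 2⁆ = (2 : ℝ) • W1.mon 1 := by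
    refine W1.ext_co fun k => ?_
    have h0 : (W1.mon 0).series = 1 := PowerSeries.monomial_zero_eq_C_apply (1 : ℝ)
    rw [W1.co_apply, W1.series_lie, h0, PowerSeries.derivative_one, map_smul, W1.co_mon, one_mul,
      mul_zero, sub_zero, PowerSeries.coeff_derivative, ← W1.co_apply, W1.co_mon]
    rcases eq_or_ne k 1 with rfl | hk
    · norm_num
    · simp [hk]
  have h1 : b ![(2 : ℝ) • W1.mon 1, W1.mon 1] = 0 := by
    have := b.map_update_smul ![W1.mon 1, W1.mon 1] 0 (2 : ℝ) (W1.mon 1)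
    rw [show Function.update ![W1.mon 1, W1.mon 1] 0 (W1.mon 1) = ![W1.mon 1, W1.mon 1] from
      Function.update_eq_self 0 ![W1.mon 1, W1.mon 1], b.map_eq_zero_of_eq ![W1.mon 1, W1.mon 1] (i := 0)
      (j := 1) rfl (by simp), smul_zero] at this
    rw [← this]
    congr 1
    funext a
    fin_cases a <;> rfl
  have h2 : b ![W1.mon 2, W1.mon 0] = - b ![W1.mon 0, W1.mon 2] := by
    have := b.toAlternatingMap.map_swap ![W1.mon 0, W1.mon 2] (i := 0) (j := 1) (by simp)
    rw [show ![W1.mon 0, W1.mon 2] ∘ Equiv.swap (0 : Fin 2) 1 = ![W1.mon 2, W1.mon 0] by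
      funext a; fin_cases a <;> rfl] at this
    exact this
  change - b ![⁅W1.mon 0, W1.mon 1⁆, W1.mon 2] + b ![⁅W1.mon 0, W1.mon 2⁆, W1.mon 1]
    - b ![⁅W1.mon 1, W1.mon 2⁆, W1.mon 0] = 1 at h
  rw [e01, e12, e02, h1, h2] at h
  norm_num at h

/-- Every cocycle is cohomologous to a multiple of the special cochain, which is a cocycle. -/
lemma exists_special_cocycle {p : ℕ} (hp : p ≤ 3) {c : (Fin p → W1) → ℝ} (hc : c ∈ cocycles p) :
    ∃ A : ℝ, (fun v => A * W1.special p v) ∈ cocycles p ∧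
      c - (fun v => A * W1.special p v) ∈ coboundaries p := by
  obtain ⟨⟨f, rfl⟩, -⟩ := mem_cocycles.1 hc
  obtain ⟨f₀, h₀, hcob, hw⟩ := exists_weight_zero f hc
  obtain ⟨N, hN⟩ := cochain_finite f₀
  have h := eq_coordForm_special W1.co W1.mon W1.co_mon hp f₀.toAlternatingMap N hN hw
  have : (fun v => f₀ v) = fun v => f₀ (fun a => W1.mon (specialIndex p a)) * W1.special p v :=
    funext h
  exact ⟨_, this ▸ h₀, this ▸ hcob⟩

/-- This one relation disposes of degrees 1 and 2 together: `ε_1` is not closed and `ε_0 ∧ ε_2` is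
exact. -/
lemma ceD_special_one (ξ : Fin 2 → W1) :
    ceD 1 (fun v => W1.special 1 v) ξ = - 2 * W1.special 2 ξ := by
  rw [ceD_one_apply]
  have h1 : ∀ v : Fin 1 → W1, W1.special 1 v = W1.co 1 (v 0) := fun v => Matrix.det_fin_one _
  have h2 : W1.special 2 ξ = _ := Matrix.det_fin_two _
  rw [h1, h2]
  change - W1.co 1 ⁅ξ 0, ξ 1⁆ = -2 * (W1.co 0 (ξ 0) * W1.co 2 (ξ 1) - W1.co 2 (ξ 0) * W1.co 0 (ξ 1))
  rw [W1.co_one_lie]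
  ring

/-- Outside degrees 0 and 3 every cocycle is a coboundary. -/
lemma mem_coboundaries_of_cocycle {p : ℕ} (h0 : p ≠ 0) (h3 : p ≠ 3) {c : (Fin p → W1) → ℝ}
    (hc : c ∈ cocycles p) : c ∈ coboundaries p := by
  by_cases hp : p ≤ 3
  · obtain ⟨A, hA, hcob⟩ := exists_special_cocycle hp hc
    rw [← sub_add_cancel c fun v => A * W1.special p v]
    refine add_mem hcob ?_
    obtain rfl | rfl : p = 1 ∨ p = 2 := by omega
    · have h := congrFun (mem_cocycles.1 hA).2 fun a => W1.mon (specialIndex 2 a)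
      have h' := congrFun ((ceD 1).map_smul A fun v => W1.special 1 v)
        fun a => W1.mon (specialIndex 2 a)
      rw [Pi.smul_apply, ceD_special_one, W1.special_mon (by norm_num)] at h'
      have hA0 : A = 0 := by
        have := h'.symm.trans h
        simpa using this
      subst hA0
      simp only [zero_mul]
      exact zero_mem _
    -- The factor `-A / 2` compensates the `-2` in `ceD_special_one`.
    · refine ⟨(-A / 2) • fun v => W1.special 1 v, ⟨(-A / 2) • W1.special 1, rfl⟩, ?_⟩
      rw [map_smul]
      funext ξ
      rw [Pi.smul_apply, ceD_special_one, smul_eq_mul]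
      ring
  · obtain ⟨⟨f, rfl⟩, -⟩ := mem_cocycles.1 hc
    obtain ⟨f₀, -, hcob, hw⟩ := exists_weight_zero f hc
    obtain ⟨N, hN⟩ := cochain_finite f₀
    have h : (fun v => f₀ v) = 0 := funext fun v =>
      eq_zero_of_weight_zero (fun k => (W1.co k).toLinearMap) W1.mon W1.co_mon hp
        f₀.toAlternatingMap N hN hw v
    rwa [h, sub_zero] at hcob

lemma subsingleton_HW1 {p : ℕ} (h0 : p ≠ 0) (h3 : p ≠ 3) : Subsingleton (HW1 p) := by
  refine Submodule.Quotient.subsingleton_iff.2 (Submodule.eq_top_iff'.2 fun c => ?_)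
  exact mem_coboundaries_of_cocycle h0 h3 c.2

/-- The cocycle `1` of degree 0 and the cocycle `ε_0 ∧ ε_1 ∧ ε_2` of degree 3. -/
lemma special_mem {p : ℕ} (hp : p = 0 ∨ p = 3) : (fun v => W1.special p v) ∈ cocycles p := by
  rcases hp with rfl | rfl
  exacts [special_zero_mem, special_three_mem]

lemma clsW1_special_ne_zero {p : ℕ} (hp : p = 0 ∨ p = 3) : clsW1 ⟨_, special_mem hp⟩ ≠ 0 := by
  refine fun h => ?_
  have h' : (fun v => W1.special p v) ∈ coboundaries p :=
    (Submodule.Quotient.mk_eq_zero ((coboundaries p).submoduleOf (cocycles p))).1 h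
  rcases hp with rfl | rfl
  · have h0 : (fun v => W1.special 0 v) = 0 := h'
    have h1 := congrFun h0 fun a => W1.mon (specialIndex 0 a)
    rw [W1.special_mon (by norm_num)] at h1
    exact one_ne_zero h1
  · exact special_three_notMem h'

lemma span_clsW1_special {p : ℕ} (hp : p = 0 ∨ p = 3) :
    Submodule.span ℝ {clsW1 ⟨_, special_mem hp⟩} = ⊤ := by
  refine Submodule.eq_top_iff'.2 fun x => ?_
  obtain ⟨c, rfl⟩ := Submodule.Quotient.mk_surjective _ x
  obtain ⟨A, -, h⟩ := exists_special_cocycle (by omega) c.2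
  refine Submodule.mem_span_singleton.2 ⟨A, ?_⟩
  exact ((Submodule.Quotient.eq _).2 (show c - A • (⟨_, special_mem hp⟩ : cocycles p) ∈ _ from h)).symm

/-! ### Lifts of maps to frames -/

lemma coeff_taylor (z : RInf) (n : ℕ) : PowerSeries.coeff n (taylor z) = z n / (n ! : ℝ) :=
  PowerSeries.coeff_mk _ _

/-- The polynomial with the `n`-jet of the frame `z`. -/
lemma jetPoly_eq_eval (z : RInf) (n : ℕ) (t : ℝ) :
    jetPoly z n t = (PowerSeries.trunc (n + 1) (taylor z)).eval t := by
  rw [Polynomial.eval_eq_sum_range' (PowerSeries.natDegree_trunc_lt _ _)]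
  refine Finset.sum_congr rfl fun p hp => ?_
  rw [PowerSeries.coeff_trunc, if_pos (Finset.mem_range.1 hp), coeff_taylor]
  ring

lemma iteratedDeriv_polynomial_zero (P : Polynomial ℝ) (n : ℕ) :
    iteratedDeriv n (fun t => P.eval t) 0 = (n ! : ℝ) * P.coeff n := by
  have h : ∀ n, iteratedDeriv n (fun t => P.eval t) =
      fun t => (Polynomial.derivative^[n] P).eval t := fun n => by
    induction n with
    | zero => simp
    | succ n ih =>
      rw [iteratedDeriv_succ, ih, Function.iterate_succ_apply']
      funext t
      exact Polynomial.deriv _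
  rw [h]
  simp only
  rw [← Polynomial.coeff_zero_eq_eval_zero, Polynomial.coeff_iterate_derivative]
  simp [Nat.descFactorial_self]

/-- The lift of a polynomial map, by substitution into the Taylor series. -/
lemma lift_polynomial (P : Polynomial ℝ) (z : RInf) (n : ℕ) :
    lift (fun t => P.eval t) z n =
      (n ! : ℝ) * PowerSeries.coeff n (Polynomial.aeval (taylor z) P) := by
  set Q := PowerSeries.trunc (n + 1) (taylor z) with hQ
  have h1 : (fun t => P.eval t) ∘ jetPoly z n = fun t => (P.comp Q).eval t := by
    funext t
    simp only [Function.comp_apply, Polynomial.eval_comp, jetPoly_eq_eval, hQ]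
  rw [lift, h1, iteratedDeriv_polynomial_zero]
  have h2 : ((P.comp Q : Polynomial ℝ) : ℝ⟦X⟧) = Polynomial.aeval (Q : ℝ⟦X⟧) P := by
    have := (Polynomial.aeval_algHom_apply (Polynomial.coeToPowerSeries.algHom (R := ℝ) ℝ) Q P).symm
    simpa [Polynomial.comp, Polynomial.aeval_def] using this
  -- Truncation is harmless: the series agree modulo `X^(n+1)`, and `a - b` divides `P(a) - P(b)`.
  have h3 : (PowerSeries.X : ℝ⟦X⟧) ^ (n + 1) ∣ taylor z - (Q : ℝ⟦X⟧) := by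
    rw [PowerSeries.X_pow_dvd_iff]
    intro m hm
    rw [map_sub, PowerSeries.coeff_coe_trunc_of_lt hm, sub_self]
  have h4 : taylor z - (Q : ℝ⟦X⟧) ∣ Polynomial.aeval (taylor z) P - Polynomial.aeval (Q : ℝ⟦X⟧) P := by
    have := Polynomial.sub_dvd_eval_sub (taylor z) (Q : ℝ⟦X⟧) (P.map (algebraMap ℝ ℝ⟦X⟧))
    simpa only [Polynomial.eval_map_algebraMap] using this
  have h5 := PowerSeries.X_pow_dvd_iff.1 (h3.trans h4) n (Nat.lt_succ_self n)
  rw [map_sub, sub_eq_zero, ← h2, Polynomial.coeff_coe] at h5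
  rw [h5]

/-- Every frame can be moved to the standard frame, up to any finite order, by a polynomial. -/
lemma exists_polynomial_inverse (z : RInf) (hz : z 1 ≠ 0) (n : ℕ) :
    ∃ P : Polynomial ℝ, P.derivative.eval (z 0) ≠ 0 ∧
      (PowerSeries.X : ℝ⟦X⟧) ^ (n + 2) ∣ Polynomial.aeval (taylor z) P - PowerSeries.X := by
  induction n with
  | zero =>
    refine ⟨Polynomial.C (z 1)⁻¹ * (Polynomial.X - Polynomial.C (z 0)), by simpa using hz, ?_⟩
    rw [PowerSeries.X_pow_dvd_iff]
    intro m hm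
    have e : Polynomial.aeval (taylor z)
        (Polynomial.C (z 1)⁻¹ * (Polynomial.X - Polynomial.C (z 0))) =
        PowerSeries.C (z 1)⁻¹ * (taylor z - PowerSeries.C (z 0)) := by
      simp
    rw [e]
    obtain rfl | rfl : m = 0 ∨ m = 1 := by omega
    · rw [map_sub, PowerSeries.coeff_C_mul, map_sub, coeff_taylor, PowerSeries.coeff_C,
        PowerSeries.coeff_X]
      simp
    · rw [map_sub, PowerSeries.coeff_C_mul, map_sub, coeff_taylor, PowerSeries.coeff_C,
        PowerSeries.coeff_X]
      simp [hz]
  | succ n ih =>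
    obtain ⟨P, hP, r, hr⟩ := ih
    obtain ⟨u, hu⟩ : (PowerSeries.X : ℝ⟦X⟧) ∣ taylor z - PowerSeries.C (z 0) := by
      rw [PowerSeries.X_dvd_iff, map_sub, ← PowerSeries.coeff_zero_eq_constantCoeff_apply,
        coeff_taylor]
      simp
    have hu0 : PowerSeries.constantCoeff u = z 1 := by
      have := congrArg (PowerSeries.coeff 1) hu
      rw [map_sub, coeff_taylor, PowerSeries.coeff_C, PowerSeries.coeff_succ_X_mul] at this
      simpa using this.symm
    -- The series minus `z 0` is `X u` with `u(0) = z 1`, so this `a` cancels the leading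
    -- coefficient of the error. The exponent `n + 2 ≥ 2` leaves the derivative at `z 0` unchanged.
    set a : ℝ := PowerSeries.constantCoeff r / z 1 ^ (n + 2) with ha
    refine ⟨P - Polynomial.C a * (Polynomial.X - Polynomial.C (z 0)) ^ (n + 2), ?_, ?_⟩
    · simpa [Polynomial.derivative_X_sub_C_pow] using hP
    · have e : Polynomial.aeval (taylor z)
          (P - Polynomial.C a * (Polynomial.X - Polynomial.C (z 0)) ^ (n + 2)) - PowerSeries.X =
          PowerSeries.X ^ (n + 2) * (r - PowerSeries.C a * u ^ (n + 2)) := by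
        have : Polynomial.aeval (taylor z)
            (P - Polynomial.C a * (Polynomial.X - Polynomial.C (z 0)) ^ (n + 2)) =
            Polynomial.aeval (taylor z) P -
              PowerSeries.C a * (taylor z - PowerSeries.C (z 0)) ^ (n + 2) := by
          simp
        rw [this, hu, sub_right_comm, hr]
        ring
      rw [e, show n + 1 + 2 = (n + 2) + 1 from rfl, pow_succ]
      refine mul_dvd_mul_left _ (PowerSeries.X_dvd_iff.2 ?_)
      rw [map_sub, map_mul, map_pow, hu0, PowerSeries.constantCoeff_C, ha,
        div_mul_cancel₀ _ (pow_ne_zero _ hz), sub_self]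

lemma ofS''_mem_frames {U : Opens ℝ} {x : RInf} (hx : x ∈ domS'' U) : ofS'' x ∈ frames U :=
  ⟨hx, (Real.exp_pos _).ne'⟩

lemma toS''_ofS'' (x : RInf) : toS'' (ofS'' x) = x := by
  funext n
  rcases n with _ | _ | n
  · rfl
  · simp [toS'', ofS'']
  · simp [toS'', ofS'']

/-- Every point of `S''(U)` can be moved to the base point, up to any finite order, by a
polynomial. -/
lemma exists_lift''_eq_zero (x : RInf) (N : ℕ) :
    ∃ P : Polynomial ℝ, P.derivative.eval (x 0) ≠ 0 ∧
      ∀ n < N, lift'' (fun t => P.eval t) x n = 0 := by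
  obtain ⟨P, hP, hdvd⟩ := exists_polynomial_inverse (ofS'' x) (Real.exp_pos _).ne' N
  refine ⟨P, hP, fun n hn => ?_⟩
  -- To finite order the image is the jet of `t ↦ t`, whose coordinates on `S''` are all zero,
  -- because `log 1 = 0`.
  have hl : ∀ m < N + 2, lift (fun t => P.eval t) (ofS'' x) m = if m = 1 then 1 else 0 := by
    intro m hm
    have := PowerSeries.X_pow_dvd_iff.1 hdvd m hm
    rw [map_sub, sub_eq_zero, PowerSeries.coeff_X] at this
    rw [lift_polynomial, this]
    split_ifs with h
    · simp [h]
    · simp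
  rcases n with _ | _ | n
  · simp [lift'', toS'', hl]
  · simp [lift'', toS'', hl]
  · simp [lift'', toS'', hl _ (show n + 2 < N + 2 by omega)]

/-- The lift of a homothety. -/
lemma lift''_mul {r : ℝ} (hr : 0 < r) (x : RInf) (n : ℕ) :
    lift'' (fun t => r * t) x n = r * (r ^ n)⁻¹ * x n + if n = 1 then Real.log r else 0 := by
  have hl : ∀ m, lift (fun t => r * t) (ofS'' x) m = r * ofS'' x m := by
    intro m
    have h := lift_polynomial (Polynomial.C r * Polynomial.X) (ofS'' x) m
    simp only [Polynomial.eval_mul, Polynomial.eval_C, Polynomial.eval_X] at h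
    rw [h, map_mul, Polynomial.aeval_C, Polynomial.aeval_X, PowerSeries.algebraMap_apply,
      Algebra.algebraMap_self_apply, PowerSeries.coeff_C_mul, coeff_taylor]
    field_simp
  rcases n with _ | _ | n
  · simp [lift'', toS'', hl, ofS'']
  · have : Real.log (|r| * Real.exp (x 1)) = x 1 + Real.log r := by
      rw [Real.log_mul (by simpa using hr.ne') (Real.exp_pos _).ne', Real.log_exp, Real.log_abs,
        add_comm]
    simp [lift'', toS'', hl, ofS'', this, hr.ne', abs_mul]
  · simp only [lift'', toS'', hl, ofS'', mul_pow]
    have := Real.exp_pos (x 1)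
    simp
    field_simp

lemma lift''_id (x : RInf) : lift'' (fun t => t) x = x := by
  funext n
  have h := lift''_mul one_pos x n
  simpa using h

/-! ### Lifts of étale maps, up to second order -/

lemma IsEtale.contDiffAt {m : ℝ → ℝ} {U V : Opens ℝ} (hm : IsEtale m U V) {t : ℝ} (ht : t ∈ U) :
    ContDiffAt ℝ (⊤ : ℕ∞) m t := hm.1.contDiffAt (U.isOpen.mem_nhds ht)

lemma IsEtale.hasDerivAt {m : ℝ → ℝ} {U V : Opens ℝ} (hm : IsEtale m U V) {t : ℝ} (ht : t ∈ U) :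
    HasDerivAt m (deriv m t) t :=
  ((hm.contDiffAt ht).differentiableAt (by simp)).hasDerivAt

lemma IsEtale.hasDerivAt_deriv {m : ℝ → ℝ} {U V : Opens ℝ} (hm : IsEtale m U V) {t : ℝ}
    (ht : t ∈ U) : HasDerivAt (deriv m) (deriv (deriv m) t) t := by
  have h : ContDiffOn ℝ 1 (deriv m) U := hm.1.deriv_of_isOpen U.isOpen (by norm_cast)
  exact ((h.contDiffAt (U.isOpen.mem_nhds ht)).differentiableAt (by simp)).hasDerivAt

lemma IsEtale.hasDerivAt_deriv_deriv {m : ℝ → ℝ} {U V : Opens ℝ} (hm : IsEtale m U V) {t : ℝ}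
    (ht : t ∈ U) : HasDerivAt (deriv (deriv m)) (deriv (deriv (deriv m)) t) t := by
  have h : ContDiffOn ℝ 2 (deriv m) U := hm.1.deriv_of_isOpen U.isOpen (by norm_cast)
  have h : ContDiffOn ℝ 1 (deriv (deriv m)) U := h.deriv_of_isOpen U.isOpen (by norm_cast)
  exact ((h.contDiffAt (U.isOpen.mem_nhds ht)).differentiableAt (by simp)).hasDerivAt

lemma lift_zero (m : ℝ → ℝ) (z : RInf) : lift m z 0 = m (z 0) := by
  simp [lift, jetPoly]

lemma lift_one {m : ℝ → ℝ} {U V : Opens ℝ} (hm : IsEtale m U V) {z : RInf} (hz : z 0 ∈ U) :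
    lift m z 1 = deriv m (z 0) * z 1 := by
  have h : jetPoly z 1 = fun t => z 0 + z 1 * t := by
    funext t; simp [jetPoly, Finset.sum_range_succ]
  have h0 : HasDerivAt (fun t : ℝ => z 0 + z 1 * t) (z 1) 0 := by
    simpa using ((hasDerivAt_id (0 : ℝ)).const_mul (z 1)).const_add (z 0)
  rw [lift, iteratedDeriv_one, h]
  exact (HasDerivAt.comp (h₂ := m) (0 : ℝ) (by simpa using hm.hasDerivAt hz) h0).deriv

/-- Second order suffices for invariance, since the canonical forms involve only `x_0`, `x_1`,
`x_2`. -/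
lemma lift_two {m : ℝ → ℝ} {U V : Opens ℝ} (hm : IsEtale m U V) {z : RInf} (hz : z 0 ∈ U) :
    lift m z 2 = deriv (deriv m) (z 0) * z 1 ^ 2 + deriv m (z 0) * z 2 := by
  have h : jetPoly z 2 = fun t => z 0 + z 1 * t + z 2 * t ^ 2 / 2 := by
    funext t; simp [jetPoly, Finset.sum_range_succ]
  have h0 : ∀ t, HasDerivAt (fun t : ℝ => z 0 + z 1 * t + z 2 * t ^ 2 / 2) (z 1 + z 2 * t) t := by
    intro t
    have h1 := ((hasDerivAt_id t).const_mul (z 1)).const_add (z 0)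
    have h2 := (((hasDerivAt_id t).pow 2).const_mul (z 2)).div_const 2
    refine (h1.add h2).congr_deriv ?_
    simp
    ring
  have hc : Continuous fun t : ℝ => z 0 + z 1 * t + z 2 * t ^ 2 / 2 := by fun_prop
  have hev : deriv (m ∘ jetPoly z 2) =ᶠ[𝓝 0]
      fun t => deriv m (z 0 + z 1 * t + z 2 * t ^ 2 / 2) * (z 1 + z 2 * t) := by
    have : ∀ᶠ t : ℝ in 𝓝 0, z 0 + z 1 * t + z 2 * t ^ 2 / 2 ∈ U :=
      hc.continuousAt.eventually_mem (U.isOpen.mem_nhds (by simpa using hz))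
    filter_upwards [this] with t ht
    rw [h]
    exact ((hm.hasDerivAt ht).comp t (h0 t)).deriv
  rw [lift, iteratedDeriv_succ, iteratedDeriv_one, hev.deriv_eq]
  have h1 : HasDerivAt (fun t => deriv m (z 0 + z 1 * t + z 2 * t ^ 2 / 2))
      (deriv (deriv m) (z 0) * z 1) 0 := by
    have h1 : HasDerivAt (deriv m) (deriv (deriv m) (z 0)) (z 0 + z 1 * 0 + z 2 * 0 ^ 2 / 2) := by
      simpa only [mul_zero, add_zero, zero_pow two_ne_zero, zero_div] using hm.hasDerivAt_deriv hz
    have h2 := h1.comp (0 : ℝ) (h0 0)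
    simp only [mul_zero, add_zero] at h2
    exact h2
  have h2 : HasDerivAt (fun t : ℝ => z 1 + z 2 * t) (z 2) 0 := by
    simpa using ((hasDerivAt_id (0 : ℝ)).const_mul (z 2)).const_add (z 1)
  rw [(h1.fun_mul h2).deriv]
  simp
  ring

lemma lift''_zero (m : ℝ → ℝ) (x : RInf) : lift'' m x 0 = m (x 0) := lift_zero m _

lemma lift''_one {m : ℝ → ℝ} {U V : Opens ℝ} (hm : IsEtale m U V) {x : RInf} (hx : x 0 ∈ U) :
    lift'' m x 1 = Real.log (deriv m (x 0)) + x 1 := by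
  change Real.log |lift m (ofS'' x) 1| = _
  rw [lift_one hm (z := ofS'' x) hx, Real.log_abs]
  change Real.log (deriv m (x 0) * Real.exp (x 1)) = _
  rw [Real.log_mul (hm.2.1 _ hx) (Real.exp_pos (x 1)).ne', Real.log_exp]

lemma lift''_two {m : ℝ → ℝ} {U V : Opens ℝ} (hm : IsEtale m U V) {x : RInf} (hx : x 0 ∈ U) :
    lift'' m x 2 = deriv (deriv m) (x 0) / deriv m (x 0) ^ 2 + x 2 / deriv m (x 0) := by
  change lift m (ofS'' x) 2 / lift m (ofS'' x) 1 ^ 2 = _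
  rw [lift_two hm (z := ofS'' x) hx, lift_one hm (z := ofS'' x) hx]
  have h1 : deriv m (x 0) ≠ 0 := hm.2.1 _ hx
  have h2 := (Real.exp_pos (x 1)).ne'
  change (deriv (deriv m) (x 0) * Real.exp (x 1) ^ 2 +
    deriv m (x 0) * (x 2 * Real.exp (x 1) ^ 2)) / (deriv m (x 0) * Real.exp (x 1)) ^ 2 = _
  field_simp

/-! ### Derivatives along lines -/

lemma hasLineDerivAt_coord (n : ℕ) (x v : RInf) :
    HasLineDerivAt ℝ (fun y : RInf => y n) (v n) x v := by
  have : HasDerivAt (fun t : ℝ => x n + t * v n) (v n) 0 := by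
    simpa using ((hasDerivAt_id (0 : ℝ)).mul_const (v n)).const_add (x n)
  exact this

lemma lineDeriv_coord (n : ℕ) (x v : RInf) : lineDeriv ℝ (fun y : RInf => y n) x v = v n :=
  (hasLineDerivAt_coord n x v).lineDeriv

lemma hasLineDerivAt_comp_coord {g : ℝ → ℝ} {g' : ℝ} (n : ℕ) (x v : RInf)
    (hg : HasDerivAt g g' (x n)) :
    HasLineDerivAt ℝ (fun y : RInf => g (y n)) (g' * v n) x v :=
  HasDerivAt.comp (h₂ := g) (0 : ℝ) (by simpa using hg) (hasLineDerivAt_coord n x v)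

lemma lineDeriv_congr_open {W : Set RInf} (hW : IsOpen W) {f g : RInf → ℝ}
    (h : ∀ y ∈ W, f y = g y) {x : RInf} (hx : x ∈ W) (v : RInf) :
    lineDeriv ℝ f x v = lineDeriv ℝ g x v := by
  have hc : Continuous fun t : ℝ => x + t • v := by fun_prop
  refine Filter.EventuallyEq.deriv_eq ?_
  filter_upwards [hc.continuousAt.eventually_mem (hW.mem_nhds (by simpa using hx))] with t ht
  exact h _ ht

/-- The tangent map of the lift of an étale map. -/
lemma lineDeriv_lift'' {m : ℝ → ℝ} {U V : Opens ℝ} (hm : IsEtale m U V) {x : RInf} (hx : x 0 ∈ U) :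
    ∃ κ : ℝ, ∀ v : RInf,
      lineDeriv ℝ (fun y => lift'' m y 0) x v = deriv m (x 0) * v 0 ∧
      lineDeriv ℝ (fun y => lift'' m y 1) x v =
        deriv (deriv m) (x 0) / deriv m (x 0) * v 0 + v 1 ∧
      lineDeriv ℝ (fun y => lift'' m y 2) x v = κ * v 0 + v 2 / deriv m (x 0) := by
  have h1 : deriv m (x 0) ≠ 0 := hm.2.1 _ hx
  have hW : IsOpen {y : RInf | y 0 ∈ U} := U.isOpen.preimage (continuous_apply 0)
  obtain ⟨q, hq⟩ : ∃ q, HasDerivAt (fun t => deriv (deriv m) t / deriv m t ^ 2) q (x 0) :=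
    ⟨_, (hm.hasDerivAt_deriv_deriv hx).fun_div ((hm.hasDerivAt_deriv hx).fun_pow 2) (pow_ne_zero 2 h1)⟩
  obtain ⟨i, hi⟩ : ∃ i, HasDerivAt (fun t => (deriv m t)⁻¹) i (x 0) :=
    ⟨_, (hm.hasDerivAt_deriv hx).fun_inv h1⟩
  -- This constant brings third derivatives of `m`, but it multiplies `dx_0` and so disappears from
  -- `dx_0 ∧ dx_2` and `dx_0 ∧ dx_1 ∧ dx_2`.
  refine ⟨q + x 2 * i, fun v => ⟨?_, ?_, ?_⟩⟩
  · simp only [lift''_zero]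
    exact (hasLineDerivAt_comp_coord 0 x v (hm.hasDerivAt hx)).lineDeriv
  · rw [lineDeriv_congr_open hW (fun y hy => lift''_one hm hy) hx]
    have := (hasLineDerivAt_comp_coord 0 x v ((hm.hasDerivAt_deriv hx).log h1))
    exact (HasDerivAt.fun_add this (hasLineDerivAt_coord 1 x v)).deriv
  · rw [lineDeriv_congr_open hW (fun y hy => lift''_two hm hy) hx]
    simp only [div_eq_mul_inv (_ : ℝ) (deriv m _)]
    have e1 := hasLineDerivAt_comp_coord 0 x v hq
    have e2 := HasDerivAt.fun_mul (hasLineDerivAt_coord 2 x v) (hasLineDerivAt_comp_coord 0 x v hi)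
    refine ((HasDerivAt.fun_add e1 e2).deriv).trans ?_
    simp only [zero_smul, add_zero]
    rw [add_mul, mul_assoc (x 2)]
    ring

/-! ### Invariant forms on `S''(pt)/ℤ` -/

/-- The chart of the point with domain `U`. -/
def ptChart (U : Opens ℝ) : (S''modZ pt).Chart := ⟨⟨U, fun _ => ()⟩, mem_univ _⟩

lemma mor_of_isEtale {m : ℝ → ℝ} {C C' : (S''modZ pt).Chart} (hm : IsEtale m C.1.U C'.1.U) :
    lift'' m ∈ (S''modZ pt).Mor C C' :=
  Or.inl ⟨m, ⟨hm, fun _ _ _ => rfl⟩, rfl⟩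

lemma pullback_lift''_id {p : ℕ} (ω : PreForm p) (x : RInf) (v : Fin p → RInf) :
    pullback (lift'' fun t => t) ω x v = ω x v := by
  simp only [pullback, lift''_id, lineDeriv_coord]

/-- An invariant form is determined by its value at the base point. -/
lemma form_eq_zero {p : ℕ} {ω : (S''modZ pt).Chart → PreForm p} (hω : ω ∈ (S''modZ pt).forms p)
    (h0 : ∀ v, ω (ptChart ⊤) 0 v = 0) : ω = 0 := by
  funext C x v
  by_cases hx : x ∈ (S''modZ pt).dom C
  · obtain ⟨k, A, η, -, h0A, -, hη⟩ := (hω.1 (ptChart ⊤)).1 0 trivial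
    obtain ⟨P, hP, hPx⟩ := exists_lift''_eq_zero x k
    have hproj : proj k (lift'' (fun t => P.eval t) x) = proj k 0 := by
      funext i
      exact hPx i i.2
    -- The polynomial is étale only where its derivative is nonzero; the smaller chart maps both to
    -- `C`, by inclusion, and to the line, by `P`.
    let U : Opens ℝ := ⟨C.1.U ∩ {t | P.derivative.eval t ≠ 0},
      C.1.U.isOpen.inter (isOpen_ne_fun P.derivative.continuous continuous_const)⟩
    have hxU : x ∈ (S''modZ pt).dom (ptChart U) := ⟨hx, hP⟩
    have het : IsEtale (fun t => P.eval t) U ⊤ :=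
      ⟨(by simpa using (P.contDiff_aeval (𝕜 := ℝ) (⊤ : ℕ∞)).contDiffOn), fun t ht => by rw [Polynomial.deriv]; exact ht.2, fun _ _ => trivial⟩
    have hid : IsEtale (fun t : ℝ => t) U C.1.U :=
      ⟨contDiff_id.contDiffOn, fun t _ => by simp, fun t ht => ht.1⟩
    have e1 := congrFun (hω.2 (ptChart U) C _ (mor_of_isEtale hid) x hxU) v
    have e2 := congrFun (hω.2 (ptChart U) (ptChart ⊤) _ (mor_of_isEtale het) x hxU) v
    rw [pullback_lift''_id] at e1
    rw [e1, ← e2]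
    change ω (ptChart ⊤) (lift'' (fun t => P.eval t) x) _ = 0
    -- The image of `x` need not be the base point, but it has the same first `k` coordinates, which
    -- are all that the form sees there.
    rw [hη _ trivial (by rw [hproj]; exact h0A), hproj, ← hη 0 trivial h0A, h0]
  · rw [(hω.1 C).2 x hx]
    rfl

/-- The value of an invariant form at the base point is an alternating form depending on finitely
many coordinates. -/
lemma exists_alternating {p : ℕ} {ω : (S''modZ pt).Chart → PreForm p}
    (hω : ω ∈ (S''modZ pt).forms p) : ∃ (f : RInf [⋀^Fin p]→ₗ[ℝ] ℝ) (N : ℕ),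
      (∀ (v : Fin p → RInf) (a : Fin p), (∀ k < N, v a k = 0) → f v = 0) ∧
      ∀ v, ω (ptChart ⊤) 0 v = f v := by
  obtain ⟨k, A, η, -, h0A, -, hη⟩ := (hω.1 (ptChart ⊤)).1 0 trivial
  refine ⟨((η (proj k 0)).compContinuousLinearMap (proj k)).toAlternatingMap, k, fun v a hv => ?_,
    hη 0 trivial h0A⟩
  refine (η (proj k 0)).map_coord_zero a ?_
  funext i
  exact hv i i.2

/-- Invariance under the homothety `t ↦ e t` and the generator of `ℤ`. -/
lemma form_dilate {p : ℕ} {ω : (S''modZ pt).Chart → PreForm p} (hω : ω ∈ (S''modZ pt).forms p)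
    (v : Fin p → RInf) :
    ω (ptChart ⊤) 0 v =
      ω (ptChart ⊤) 0 fun a n => Real.exp 1 * (Real.exp 1 ^ n)⁻¹ * v a n := by
  have he : (0 : ℝ) < Real.exp 1 := Real.exp_pos 1
  have het : IsEtale (fun t => Real.exp 1 * t) ⊤ ⊤ :=
    ⟨by fun_prop, fun t _ => by simp, fun _ _ => trivial⟩
  have e1 := congrFun (hω.2 (ptChart ⊤) (ptChart ⊤) _ (mor_of_isEtale het) 0 trivial) v
  have e2 := hω.2 (ptChart ⊤) (ptChart ⊤) _ (Or.inr ⟨rfl, -1, rfl⟩) (Pi.single 1 1) trivial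
  have hpt : lift'' (fun t => Real.exp 1 * t) 0 = Pi.single 1 1 := by
    funext n
    -- The homothety sends `0` to the point with `x_1 = log e = 1`, so the generator `-1` of `ℤ`
    -- brings it back exactly.
    rw [lift''_mul he, Pi.single_apply]
    simp
  have hD : ∀ (n : ℕ) (w : RInf), lineDeriv ℝ (fun y => lift'' (fun t => Real.exp 1 * t) y n) 0 w =
      Real.exp 1 * (Real.exp 1 ^ n)⁻¹ * w n := by
    intro n w
    simp only [lift''_mul he]
    have h := (hasLineDerivAt_coord n 0 w).const_mul (Real.exp 1 * (Real.exp 1 ^ n)⁻¹)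
    exact (h.add_const (if n = 1 then Real.log (Real.exp 1) else 0)).deriv
  have hT : Function.update (Pi.single 1 1 : RInf) 1
      ((Pi.single 1 1 : RInf) 1 + ((-1 : ℤ) : ℝ)) = 0 := by
    funext n
    rcases eq_or_ne n 1 with rfl | hn
    · simp
    · simp [hn]
  have hDT : ∀ (n : ℕ) (x w : RInf), lineDeriv ℝ
      (fun y : RInf => Function.update y 1 (y 1 + ((-1 : ℤ) : ℝ)) n) x w = w n := by
    intro n x w
    rcases eq_or_ne n 1 with rfl | hn
    · simp only [Function.update_self]
      exact ((hasLineDerivAt_coord 1 x w).add_const _).deriv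
    · simp only [Function.update_of_ne hn, lineDeriv_coord]
  rw [← e1]
  simp only [pullback, hpt, hD]
  rw [← e2]
  simp only [pullback, hT, hDT]

/-- The standard basis of the tangent space of `ℝ^∞`. -/
lemma single_coord (k j : ℕ) : (Pi.single j (1 : ℝ) : RInf) k = if k = j then 1 else 0 := by
  rw [Pi.single_apply]

/-- The basis vectors are eigenvectors, so the value at `I` is multiplied by `e^(p - ∑ I)`; this
factor is 1 only when the sum is `p`. -/
lemma weight_zero_of_dilate {p : ℕ} (f : RInf [⋀^Fin p]→ₗ[ℝ] ℝ)
    (hf : ∀ v, f v = f fun a n => Real.exp 1 * (Real.exp 1 ^ n)⁻¹ * v a n)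
    (I : Fin p → ℕ) (hI : ∑ a, I a ≠ p) : f (fun a => Pi.single (I a) 1) = 0 := by
  have h := hf fun a => Pi.single (I a) 1
  have h1 : (fun a n => Real.exp 1 * (Real.exp 1 ^ n)⁻¹ * (Pi.single (I a) (1 : ℝ) : RInf) n) =
      fun a => (Real.exp 1 * (Real.exp 1 ^ I a)⁻¹) • (Pi.single (I a) 1 : RInf) := by
    funext a n
    simp only [Pi.smul_apply, single_coord, smul_eq_mul]
    split_ifs with h
    · rw [h]
    · simp
  rw [h1] at h
  have h2 := f.toMultilinearMap.map_smul_univ (fun a => Real.exp 1 * (Real.exp 1 ^ I a)⁻¹)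
    fun a => (Pi.single (I a) 1 : RInf)
  have h3 := h.trans h2
  by_contra hne
  have h4 : ∏ a, (Real.exp 1 * (Real.exp 1 ^ I a)⁻¹) = 1 :=
    mul_right_cancel₀ hne (h3.symm.trans (one_mul _).symm)
  rw [Finset.prod_mul_distrib, Finset.prod_inv_distrib, Finset.prod_pow_eq_pow_sum,
    Finset.prod_const, Finset.card_univ, Fintype.card_fin, ← div_eq_mul_inv,
    div_eq_one_iff_eq (by positivity)] at h4
  exact hI (pow_right_injective₀ (Real.exp_pos 1) (by simp) h4).symm

/-- The coordinate functions of `ℝ^∞`. -/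
def coord (k : ℕ) : RInf →L[ℝ] ℝ := ContinuousLinearMap.proj k

/-- In degrees above three there are no invariant forms. -/
lemma form_eq_zero_of_degree {p : ℕ} (hp : ¬ p ≤ 3) {ω : (S''modZ pt).Chart → PreForm p}
    (hω : ω ∈ (S''modZ pt).forms p) : ω = 0 := by
  obtain ⟨f, N, hN, hf⟩ := exists_alternating hω
  refine form_eq_zero hω fun v => ?_
  rw [hf]
  refine eq_zero_of_weight_zero (fun k => (coord k).toLinearMap) (fun k => Pi.single k 1)
    single_coord hp f N hN (weight_zero_of_dilate f fun v => ?_) v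
  rw [← hf, ← hf, ← form_dilate hω]

/-- The canonical invariant forms `1`, `dx_1 - x_2 dx_0`, `dx_0 ∧ dx_2`, `dx_0 ∧ dx_1 ∧ dx_2`. -/
def canon : (p : ℕ) → PreForm p
  | 1 => fun x v => v 0 1 - x 2 * v 0 0
  | p => fun _ v => coordForm coord (specialIndex p) v

/-- The only non-constant coefficient is `x_2`, which vanishes at the base point. -/
lemma canon_base (p : ℕ) (v : Fin p → RInf) :
    canon p 0 v = coordForm coord (specialIndex p) v := by
  rcases p with _ | _ | p
  · rfl
  · have : coordForm coord (specialIndex 1) v = v 0 1 := Matrix.det_fin_one _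
    rw [this]
    simp [canon]
  · rfl

lemma canon_two (x : RInf) (v : Fin 2 → RInf) : canon 2 x v = v 0 0 * v 1 2 - v 0 2 * v 1 0 :=
  Matrix.det_fin_two _

lemma canon_three (x : RInf) (v : Fin 3 → RInf) :
    canon 3 x v = Matrix.det (Matrix.of fun a b : Fin 3 => v a b) := rfl

lemma canon_const {p : ℕ} (hp : p ≠ 1) (x : RInf) (v : Fin p → RInf) :
    canon p x v = coordForm coord (specialIndex p) v := by
  rcases p with _ | _ | p
  · rfl
  · exact absurd rfl hp
  · rfl

/-- The canonical forms are invariant under étale maps. -/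
lemma pullback_canon {p : ℕ} (hp : p ≤ 3) {m : ℝ → ℝ} {U V : Opens ℝ} (hm : IsEtale m U V)
    {x : RInf} (hx : x 0 ∈ U) : pullback (lift'' m) (canon p) x = canon p x := by
  funext v
  obtain ⟨κ, hκ⟩ := lineDeriv_lift'' hm hx
  have h1 : deriv m (x 0) ≠ 0 := hm.2.1 _ hx
  obtain rfl | rfl | rfl | rfl : p = 0 ∨ p = 1 ∨ p = 2 ∨ p = 3 := by omega
  · exact congrArg (coordForm coord (specialIndex 0)) (Subsingleton.elim _ _)
  -- The term `m''/m' · dx_0` from `d log m'` cancels against the inhomogeneous part `m''/m'^2` of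
  -- the new `x_2`.
  · simp only [pullback, canon, hκ, lift''_two hm hx]
    field_simp
    ring
  · simp only [pullback, canon_two, hκ]
    field_simp
    ring
  · simp only [pullback, canon_three, Matrix.det_fin_three, Matrix.of_apply, Fin.val_zero,
      Fin.val_one, Fin.val_two, hκ]
    field_simp
    ring

/-- The canonical forms are invariant under the action of `ℤ`. -/
lemma pullback_translation_canon (p : ℕ) (r : ℝ) (x : RInf) :
    pullback (fun x : RInf => Function.update x 1 (x 1 + r)) (canon p) x = canon p x := by
  funext v
  have hD : ∀ (n : ℕ) (w : RInf),
      lineDeriv ℝ (fun y : RInf => Function.update y 1 (y 1 + r) n) x w = w n := by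
    intro n w
    rcases eq_or_ne n 1 with rfl | hn
    · simp only [Function.update_self]
      exact ((hasLineDerivAt_coord 1 x w).add_const _).deriv
    · simp only [Function.update_of_ne hn, lineDeriv_coord]
  simp only [pullback, hD]
  by_cases hp : p = 1
  · subst hp
    simp [canon]
  · rw [canon_const hp, canon_const hp]

/-- The family of restrictions of a form on `ℝ^∞` to the charts. -/
def family {p : ℕ} (χ : PreForm p) : (S''modZ pt).Chart → PreForm p := fun C x v =>
  open Classical in if x ∈ (S''modZ pt).dom C then χ x v else 0

lemma family_apply {p : ℕ} (χ : PreForm p) {C : (S''modZ pt).Chart} {x : RInf}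
    (hx : x ∈ (S''modZ pt).dom C) (v : Fin p → RInf) : family χ C x v = χ x v := if_pos hx

lemma isSmoothForm_family {p : ℕ} {χ : PreForm p} (hχ : IsSmoothForm ⊤ χ)
    (C : (S''modZ pt).Chart) : IsSmoothForm ((S''modZ pt).dom C) (family χ C) := by
  refine ⟨fun x _ => ?_, fun x hx => funext fun v => if_neg hx⟩
  obtain ⟨k, A, η, hA, hxA, hη, h⟩ := hχ.1 x trivial
  exact ⟨k, A, η, hA, hxA, hη, fun y hy hyA v => (family_apply χ hy v).trans (h y trivial hyA v)⟩

lemma isSmoothForm_coordForm {p : ℕ} (I : Fin p → ℕ) {k : ℕ} (hI : ∀ a, I a < k)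
    {g : (Fin k → ℝ) → ℝ} (hg : ContDiff ℝ (⊤ : ℕ∞) g) :
    IsSmoothForm ⊤ fun x v => g (proj k x) * coordForm coord I v := by
  refine ⟨fun x _ => ?_, fun x hx => absurd trivial hx⟩
  let co : ℕ → (Fin k → ℝ) →L[ℝ] ℝ := fun n =>
    if h : n < k then ContinuousLinearMap.proj ⟨n, h⟩ else 0
  refine ⟨k, univ, fun y => g y • coordForm co I, isOpen_univ, mem_univ _,
    (hg.smul contDiff_const).contDiffOn, fun y _ _ v => ?_⟩
  change g (proj k y) * coordForm coord I v = g (proj k y) * coordForm co I fun a => proj k (v a)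
  rw [coordForm_apply, coordForm_apply]
  congr 3
  ext a b
  simp [co, hI b, coord, proj]

lemma isSmoothForm_canon {p : ℕ} (hp : p ≤ 3) : IsSmoothForm ⊤ (canon p) := by
  by_cases h1 : p = 1
  · subst h1
    have e1 := isSmoothForm_coordForm (fun _ : Fin 1 => 1) (k := 3) (by simp) (g := fun _ => 1)
      contDiff_const
    have e2 := isSmoothForm_coordForm (fun _ : Fin 1 => 0) (k := 3) (by simp) (g := fun y => - y 2)
      (by fun_prop)
    convert! e1.add e2 using 1
    funext x v
    have d : ∀ n, coordForm coord (fun _ : Fin 1 => n) v = v 0 n := fun n => Matrix.det_fin_one _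
    simp only [Pi.add_apply, d]
    change v 0 1 - x 2 * v 0 0 = 1 * v 0 1 + -(x 2) * v 0 0
    ring
  · have := isSmoothForm_coordForm (specialIndex p) (specialIndex_lt hp) (g := fun _ => 1)
      contDiff_const
    convert! this using 1
    funext x v
    rw [canon_const h1, one_mul]

lemma family_canon_mem {p : ℕ} (hp : p ≤ 3) : family (canon p) ∈ (S''modZ pt).forms p := by
  refine ⟨isSmoothForm_family (isSmoothForm_canon hp), fun C C' M hM x hx => ?_⟩
  funext v
  rw [family_apply _ hx]
  rcases hM with ⟨m, hm, rfl⟩ | ⟨rfl, n, rfl⟩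
  · have hx' : lift'' m x ∈ (S''modZ pt).dom C' := by
      change lift'' m x 0 ∈ C'.1.U
      rw [lift''_zero]
      exact hm.1.2.2 _ hx
    exact (family_apply (canon p) hx' _).trans (congrFun (pullback_canon hp hm.1 hx) v)
  · have hx' : Function.update x 1 (x 1 + n) ∈ (S''modZ pt).dom C := hx
    exact (family_apply (canon p) hx' _).trans (congrFun (pullback_translation_canon p n x) v)

/-- The invariant forms of degree at most three are multiples of the canonical form. -/
lemma exists_eq_smul_canon {p : ℕ} (hp : p ≤ 3) {ω : (S''modZ pt).Chart → PreForm p}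
    (hω : ω ∈ (S''modZ pt).forms p) : ∃ A : ℝ, ω = A • family (canon p) := by
  obtain ⟨f, N, hN, hf⟩ := exists_alternating hω
  have h := eq_coordForm_special coord (fun k => Pi.single k 1) single_coord hp f N hN
    (weight_zero_of_dilate f fun v => by rw [← hf, ← hf, ← form_dilate hω])
  refine ⟨f fun a => Pi.single (specialIndex p a) 1, sub_eq_zero.1 (form_eq_zero
    (sub_mem hω (Submodule.smul_mem _ _ (family_canon_mem hp))) fun v => ?_)⟩
  change ω (ptChart ⊤) 0 v - _ * family (canon p) (ptChart ⊤) 0 v = 0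
  rw [hf, h, family_apply _ (C := ptChart ⊤) trivial, canon_base, sub_self]

lemma extD_apply {W : Opens RInf} {p : ℕ} (ω : PreForm p) {x : RInf} (hx : x ∈ W)
    (v : Fin (p + 1) → RInf) : extD W ω x v =
    ∑ i : Fin (p + 1), (-1 : ℝ) ^ (i : ℕ) * lineDeriv ℝ (fun y => ω y (i.removeNth v)) x (v i) :=
  if_pos hx

lemma extD_family {p : ℕ} (χ : PreForm p) (C : (S''modZ pt).Chart) {x : RInf}
    (hx : x ∈ (S''modZ pt).dom C) (v : Fin (p + 1) → RInf) :
    extD ((S''modZ pt).dom C) (family χ C) x v =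
      ∑ i : Fin (p + 1), (-1 : ℝ) ^ (i : ℕ) *
        lineDeriv ℝ (fun y => χ y (i.removeNth v)) x (v i) := by
  rw [extD_apply _ hx]
  refine Finset.sum_congr rfl fun i _ => congrArg _ ?_
  exact lineDeriv_congr_open ((S''modZ pt).dom C).isOpen (fun y hy => family_apply χ hy _) hx _

lemma family_canon_closed {p : ℕ} (hp : p ≤ 3) (h1 : p ≠ 1) :
    family (canon p) ∈ (S''modZ pt).closedForms p := by
  refine ⟨family_canon_mem hp, fun C => ?_⟩
  funext x v
  by_cases hx : x ∈ (S''modZ pt).dom C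
  · rw [extD_family _ _ hx]
    refine Finset.sum_eq_zero fun i _ => ?_
    simp only [canon_const h1]
    rw [show lineDeriv ℝ (fun _ : RInf => coordForm coord (specialIndex p) (i.removeNth v)) x (v i)
      = 0 from deriv_const _ _, mul_zero]
  · exact if_neg hx

/-- The counterpart of `ceD_special_one`: it removes the cohomology in degrees 1 and 2. -/
lemma extD_canon_one (C : (S''modZ pt).Chart) :
    extD ((S''modZ pt).dom C) (family (canon 1) C) = family (canon 2) C := by
  funext x v
  by_cases hx : x ∈ (S''modZ pt).dom C
  · rw [extD_family _ _ hx, family_apply _ hx, canon_two, Fin.sum_univ_two]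
    have h : ∀ w u : RInf, lineDeriv ℝ (fun y : RInf => w 1 - y 2 * w 0) x u = - (u 2 * w 0) :=
      fun w u => (((hasLineDerivAt_coord 2 x u).mul_const (w 0)).const_sub (w 1)).deriv
    have e0 : lineDeriv ℝ (fun y => canon 1 y (Fin.removeNth 0 v)) x (v 0) = _ := h (v 1) (v 0)
    have e1 : lineDeriv ℝ (fun y => canon 1 y (Fin.removeNth 1 v)) x (v 1) = _ := h (v 0) (v 1)
    rw [e0, e1]
    simp
    ring
  · exact (if_neg hx).trans (if_neg hx).symm

lemma canon_base_special {p : ℕ} (hp : p ≤ 3) :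
    family (canon p) (ptChart ⊤) 0 (fun a => Pi.single (specialIndex p a) 1) = 1 := by
  rw [family_apply _ (C := ptChart ⊤) trivial, canon_base]
  exact coordForm_special coord (fun k => Pi.single k 1) single_coord hp

/-! ### The cohomology of `S''(pt)/ℤ` -/

/-- There are no closed invariant 1-forms. -/
lemma closed_one_eq_zero {ω : (S''modZ pt).Chart → PreForm 1}
    (hω : ω ∈ (S''modZ pt).closedForms 1) : ω = 0 := by
  obtain ⟨A, rfl⟩ := exists_eq_smul_canon (by norm_num) hω.1
  have h := congrFun (congrFun (hω.2 (ptChart ⊤)) 0) fun a => Pi.single (specialIndex 2 a) 1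
  rw [Pi.smul_apply, extD_smul, extD_canon_one, Pi.smul_apply, Pi.smul_apply,
    canon_base_special (by norm_num)] at h
  have hA : A = 0 := by simpa using h
  rw [hA, zero_smul]

lemma family_two_exact : family (canon 2) ∈ (S''modZ pt).exactForms 2 :=
  ⟨family (canon 1), family_canon_mem (by norm_num), fun C => (extD_canon_one C).symm⟩

lemma closed_mem_exact {p : ℕ} (h0 : p ≠ 0) (h3 : p ≠ 3) {ω : (S''modZ pt).Chart → PreForm p}
    (hω : ω ∈ (S''modZ pt).closedForms p) : ω ∈ (S''modZ pt).exactForms p := by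
  by_cases hp : p ≤ 3
  · obtain rfl | rfl : p = 1 ∨ p = 2 := by omega
    · rw [closed_one_eq_zero hω]
      exact zero_mem _
    · obtain ⟨A, rfl⟩ := exists_eq_smul_canon (by norm_num) hω.1
      exact Submodule.smul_mem _ _ family_two_exact
  · rw [form_eq_zero_of_degree hp hω.1]
    exact zero_mem _

lemma subsingleton_H {p : ℕ} (h0 : p ≠ 0) (h3 : p ≠ 3) : Subsingleton ((S''modZ pt).H p) := by
  refine Submodule.Quotient.subsingleton_iff.2 (Submodule.eq_top_iff'.2 fun ω => ?_)
  exact closed_mem_exact h0 h3 ω.2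

lemma canon_mem_closed {p : ℕ} (hp : p = 0 ∨ p = 3) :
    family (canon p) ∈ (S''modZ pt).closedForms p :=
  family_canon_closed (by omega) (by omega)

/-- Every invariant 2-form is a multiple of the closed form `canon 2`, so the only exact 3-form is
zero; in degree 0 exactness means vanishing. -/
lemma canon_notMem_exact {p : ℕ} (hp : p = 0 ∨ p = 3) :
    family (canon p) ∉ (S''modZ pt).exactForms p := by
  intro h
  have h1 := canon_base_special (p := p) (by omega)
  have h2 : family (canon p) = 0 := by
    rcases hp with rfl | rfl
    · exact h
    · obtain ⟨η, hη, h⟩ := h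
      obtain ⟨A, rfl⟩ := exists_eq_smul_canon (by norm_num) hη
      funext C
      rw [h C, Pi.smul_apply, extD_smul, (family_canon_closed (by norm_num) (by norm_num)).2 C,
        smul_zero]
      rfl
  rw [h2] at h1
  exact zero_ne_one h1

lemma cls_smul_canon_ne_zero {p : ℕ} (hp : p = 0 ∨ p = 3) {A : ℝ} (hA : A ≠ 0) :
    (S''modZ pt).cls (A • ⟨_, canon_mem_closed hp⟩) ≠ 0 := by
  intro h
  have h1 : A • family (canon p) ∈ (S''modZ pt).exactForms p :=
    (Submodule.Quotient.mk_eq_zero (((S''modZ pt).exactForms p).submoduleOf _)).1 h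
  exact canon_notMem_exact hp ((Submodule.smul_mem_iff _ hA).1 h1)

/-- The factor `A` allows generators other than the canonical form itself, such as `gvl`, where it
is `-1`. -/
lemma exists_eq_smul_closed {p : ℕ} (hp : p = 0 ∨ p = 3) {A : ℝ} (hA : A ≠ 0)
    (ω : (S''modZ pt).closedForms p) : ∃ B : ℝ, ω = B • A • ⟨_, canon_mem_closed hp⟩ := by
  obtain ⟨B, hB⟩ := exists_eq_smul_canon (by omega) ω.2.1
  refine ⟨B * A⁻¹, Subtype.ext ?_⟩
  change ω.1 = (B * A⁻¹) • A • family (canon p)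
  rw [hB, smul_smul, inv_mul_cancel_right₀ hA]

lemma span_cls_smul_canon {p : ℕ} (hp : p = 0 ∨ p = 3) {A : ℝ} (hA : A ≠ 0) :
    Submodule.span ℝ {(S''modZ pt).cls (A • ⟨_, canon_mem_closed hp⟩)} = ⊤ := by
  refine Submodule.eq_top_iff'.2 fun x => ?_
  obtain ⟨ω, rfl⟩ := Submodule.Quotient.mk_surjective _ x
  obtain ⟨B, rfl⟩ := exists_eq_smul_closed hp hA ω
  exact Submodule.mem_span_singleton.2 ⟨B, rfl⟩

/-! ### Comparison with the Gelfand–Kazhdan form -/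

/-- The tangent map of the projection `S(U) → S''(U)`. -/
lemma lineDeriv_toS'' {z : RInf} (hz : z 1 ≠ 0) (v : RInf) :
    lineDeriv ℝ (fun y => toS'' y 0) z v = v 0 ∧
    lineDeriv ℝ (fun y => toS'' y 1) z v = v 1 / z 1 ∧
    ∀ n, lineDeriv ℝ (fun y => toS'' y (n + 2)) z v =
      v (n + 2) / z 1 ^ (n + 2) - (n + 2) * z (n + 2) * v 1 / z 1 ^ (n + 3) := by
  refine ⟨lineDeriv_coord 0 z v, ?_, fun n => ?_⟩
  · change lineDeriv ℝ (fun y : RInf => Real.log |y 1|) z v = _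
    simp only [Real.log_abs]
    rw [(hasLineDerivAt_comp_coord 1 z v (Real.hasDerivAt_log hz)).lineDeriv]
    ring
  · have h1 := (hasDerivAt_id (z 1)).fun_pow (n + 2)
    have h2 := hasLineDerivAt_comp_coord 1 z v h1
    have h3 := HasDerivAt.fun_div (hasLineDerivAt_coord (n + 2) z v) h2
      (by simpa using pow_ne_zero (n + 2) hz)
    refine h3.deriv.trans ?_
    simp
    field_simp
    ring

/-- These are the first coefficients of minus the quotient of two Taylor series. The constant `κ`
stays implicit: it multiplies `v 0`, hence contributes a multiple of `θ_0`, which drops out of any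
wedge product with `θ_0`. -/
lemma co_theta {z : RInf} (hz : z 1 ≠ 0) : ∃ κ : ℝ, ∀ v : RInf,
    W1.co 0 (theta z v) = - (v 0 / z 1) ∧
    W1.co 1 (theta z v) = - (v 1 / z 1) + v 0 * z 2 / z 1 ^ 2 ∧
    W1.co 2 (theta z v) = - (v 2 / (2 * z 1)) + v 1 * z 2 / z 1 ^ 2 + κ * v 0 := by
  set D : ℝ⟦X⟧ := d⁄dX ℝ (taylor z) with hD
  have c0 : PowerSeries.constantCoeff D = z 1 := by
    rw [hD, ← PowerSeries.coeff_zero_eq_constantCoeff_apply, PowerSeries.coeff_derivative,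
      coeff_taylor]
    simp
  have c1 : PowerSeries.coeff 1 D = z 2 := by
    rw [hD, PowerSeries.coeff_derivative, coeff_taylor]
    norm_num
  have w0 : PowerSeries.constantCoeff D⁻¹ = (z 1)⁻¹ := by
    rw [PowerSeries.constantCoeff_inv, c0]
  have w1 : PowerSeries.coeff 1 D⁻¹ = - (z 2 / z 1 ^ 2) := by
    have h := congrArg (PowerSeries.coeff 1) (PowerSeries.mul_inv_cancel D (by rwa [c0]))
    simp [PowerSeries.coeff_mul, Finset.Nat.antidiagonal_succ, c0, c1, w0,
      PowerSeries.coeff_one] at h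
    field_simp at h ⊢
    linarith
  refine ⟨- PowerSeries.coeff 2 D⁻¹, fun v => ?_⟩
  have hθ : ∀ k, W1.co k (theta z v) = - PowerSeries.coeff k (taylor v * D⁻¹) := fun k =>
    map_neg (PowerSeries.coeff k) _
  have t0 : PowerSeries.constantCoeff (taylor v) = v 0 := by
    rw [← PowerSeries.coeff_zero_eq_constantCoeff_apply, coeff_taylor]
    simp
  refine ⟨?_, ?_, ?_⟩
  · rw [hθ]
    simp [t0, w0, div_eq_mul_inv]
  · rw [hθ]
    simp [PowerSeries.coeff_mul, Finset.Nat.antidiagonal_succ, coeff_taylor, w0, w1]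
    ring
  · rw [hθ]
    simp [PowerSeries.coeff_mul, Finset.Nat.antidiagonal_succ, coeff_taylor, w0, w1]
    ring

lemma W1.special_apply_two (v : Fin 2 → W1) :
    W1.special 2 v = W1.co 0 (v 0) * W1.co 2 (v 1) - W1.co 2 (v 0) * W1.co 0 (v 1) :=
  Matrix.det_fin_two _

/-- The constant is read off from the coefficients of `dz_0 ∧ dz_1 ∧ dz_2`: it is `1 / z_1^3` for
the canonical form and `-1 / (2 z_1^3)` for the special cochain on `θ`. -/
lemma pullback_toS''_canon_three {z : RInf} (hz : z 1 ≠ 0) (v : Fin 3 → RInf) :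
    pullback toS'' (canon 3) z v = -2 * W1.special 3 fun a => theta z (v a) := by
  obtain ⟨κ, hκ⟩ := co_theta hz
  have h2 := fun w => (lineDeriv_toS'' hz w).2.2 0
  simp only [zero_add] at h2
  simp only [pullback, canon_three, W1.special_apply_three, Matrix.det_fin_three, Matrix.of_apply,
    Fin.val_zero, Fin.val_one, Fin.val_two, hκ, h2, lineDeriv_toS'' hz]
  field_simp
  simp
  ring

/-- The pullbacks to the frames of the canonical forms other than `dx_1 - x_2 dx_0`. -/
lemma pullback_toS''_canon {p : ℕ} (hp : p ≤ 3) (h1 : p ≠ 1) : ∃ B : ℝ, B ≠ 0 ∧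
    ∀ z : RInf, z 1 ≠ 0 → ∀ v : Fin p → RInf,
      pullback toS'' (canon p) z v = B * W1.special p fun a => theta z (v a) := by
  obtain rfl | rfl | rfl : p = 0 ∨ p = 2 ∨ p = 3 := by omega
  · refine ⟨1, one_ne_zero, fun z hz v => ?_⟩
    rw [one_mul]
    exact (Matrix.det_fin_zero).trans Matrix.det_fin_zero.symm
  · refine ⟨2, two_ne_zero, fun z hz v => ?_⟩
    obtain ⟨κ, hκ⟩ := co_theta hz
    have h2 := fun w => (lineDeriv_toS'' hz w).2.2 0
    simp only [zero_add] at h2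
    simp only [pullback, canon_two, W1.special_apply_two, hκ, h2, lineDeriv_toS'' hz]
    field_simp
    simp
    ring
  · exact ⟨-2, by norm_num, fun z hz v => pullback_toS''_canon_three hz v⟩

/-- The factor 2 is `0! · 1! · 2!`, from the normalisation of the `θ_k`; the matrix is also
transposed. -/
lemma det_thetaK (z : RInf) (v : Fin 3 → RInf) :
    Matrix.det (Matrix.of fun i j : Fin 3 => thetaK i z (v j)) =
      2 * W1.special 3 fun a => theta z (v a) := by
  have h : ∀ k w, thetaK k z w = (k ! : ℝ) * W1.co k (theta z w) := fun _ _ => rfl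
  simp only [W1.special_apply_three, Matrix.det_fin_three, Matrix.of_apply, Fin.val_zero,
    Fin.val_one, Fin.val_two, h]
  simp
  ring

lemma pullback_toS''_family {p : ℕ} (χ : PreForm p) {C : (S''modZ pt).Chart} {z : RInf}
    (hz : z ∈ frames C.1.U) (v : Fin p → RInf) :
    pullback toS'' (family χ C) z v = pullback toS'' χ z v :=
  family_apply χ (show toS'' z ∈ (S''modZ pt).dom C from hz.1) _

/-- Needed although its class is trivial: closed invariant 2-forms must also be expressed by a
cocycle of `θ`. -/
lemma special_two_mem : (fun v => W1.special 2 v) ∈ cocycles 2 := by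
  refine mem_cocycles.2 ⟨⟨_, rfl⟩, ?_⟩
  funext ξ
  rw [ceD_two_apply]
  simp only [W1.special_apply_two, Matrix.cons_val, W1.co_zero_lie, W1.co_two_lie, Pi.zero_apply]
  ring

/-- A closed invariant form is the value of a cocycle on the Gelfand–Kazhdan form. -/
lemma exists_cocycle {p : ℕ} (ω : (S''modZ pt).closedForms p) : ∃ c : cocycles p,
    ∀ C, ∀ z ∈ frames C.1.U, ∀ v : Fin p → RInf,
      pullback toS'' (ω.1 C) z v = c.1 fun a => theta z (v a) := by
  by_cases h : p ≤ 3 ∧ p ≠ 1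
  · obtain ⟨B, -, hB⟩ := pullback_toS''_canon h.1 h.2
    obtain ⟨A, hA⟩ := exists_eq_smul_canon h.1 ω.2.1
    have hmem : (fun v => W1.special p v) ∈ cocycles p := by
      obtain rfl | rfl | rfl : p = 0 ∨ p = 2 ∨ p = 3 := by omega
      exacts [special_zero_mem, special_two_mem, special_three_mem]
    refine ⟨(A * B) • ⟨_, hmem⟩, fun C z hz v => ?_⟩
    rw [hA]
    change A * pullback toS'' (family (canon p) C) z v = A * B * W1.special p fun a => theta z (v a)
    rw [pullback_toS''_family _ hz, hB z hz.2, mul_assoc]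
  · refine ⟨0, fun C z hz v => ?_⟩
    have hω : ω.1 = 0 := by
      by_cases h1 : p = 1
      · subst h1
        exact closed_one_eq_zero ω.2
      · exact form_eq_zero_of_degree (fun h' => h ⟨h', h1⟩) ω.2.1
    rw [hω]
    rfl

lemma exists_linearEquiv_of_span {V W : Type*} [AddCommGroup V] [Module ℝ V] [AddCommGroup W]
    [Module ℝ W] {x : V} {y : W} (hx : x ≠ 0) (hxs : Submodule.span ℝ {x} = ⊤) (hy : y ≠ 0)
    (hys : Submodule.span ℝ {y} = ⊤) : ∃ e : V ≃ₗ[ℝ] W, e x = y := by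
  let a : ℝ ≃ₗ[ℝ] V := (LinearEquiv.toSpanNonzeroSingleton ℝ V x hx).trans (LinearEquiv.ofTop _ hxs)
  let b : ℝ ≃ₗ[ℝ] W := (LinearEquiv.toSpanNonzeroSingleton ℝ W y hy).trans (LinearEquiv.ofTop _ hys)
  have ha : a 1 = x := one_smul ℝ x
  have hb : b 1 = y := one_smul ℝ y
  refine ⟨a.symm.trans b, ?_⟩
  rw [LinearEquiv.trans_apply, ← ha, LinearEquiv.symm_apply_apply, hb]

/-- The isomorphism `H^p(S''(pt)/ℤ) ≃ H^p(W_1)` induced by `θ`. -/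
lemma exists_iso (p : ℕ) : ∃ e : (S''modZ pt).H p ≃ₗ[ℝ] HW1 p,
    ∀ ω : (S''modZ pt).closedForms p, ∃ c : cocycles p,
      (∀ C, ∀ z ∈ frames C.1.U, ∀ v : Fin p → RInf,
        pullback toS'' (ω.1 C) z v = c.1 fun a => theta z (v a)) ∧
      e ((S''modZ pt).cls ω) = clsW1 c := by
  by_cases hp : p = 0 ∨ p = 3
  · obtain ⟨B, hB0, hB⟩ := pullback_toS''_canon (p := p) (by omega) (by omega)
    -- Both groups are lines. Compatibility with `θ` dictates the image of the generator: `B` times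
    -- the special class, since `canon p` pulls back to `B` times the special cochain on `θ`.
    obtain ⟨e, he⟩ := exists_linearEquiv_of_span (cls_smul_canon_ne_zero hp one_ne_zero)
      (span_cls_smul_canon hp one_ne_zero) (smul_ne_zero hB0 (clsW1_special_ne_zero hp))
      (y := B • clsW1 ⟨_, special_mem hp⟩)
      (by rw [Submodule.span_singleton_smul_eq (IsUnit.mk0 B hB0), span_clsW1_special hp])
    refine ⟨e, fun ω => ?_⟩
    obtain ⟨A, rfl⟩ := exists_eq_smul_closed hp one_ne_zero ω
    refine ⟨A • B • ⟨_, special_mem hp⟩, fun C z hz v => ?_, ?_⟩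
    · change A * (1 * pullback toS'' (family (canon p) C) z v) =
        A * (B * W1.special p fun a => theta z (v a))
      rw [pullback_toS''_family _ hz, hB z hz.2, one_mul]
    · exact (e.map_smul A _).trans (congrArg (A • ·) he)
  · have := subsingleton_H (p := p) (by tauto) (by tauto)
    have := subsingleton_HW1 (p := p) (by tauto) (by tauto)
    -- Both groups vanish, so only the existence of the cocycle has content.
    refine ⟨LinearEquiv.ofSubsingleton _ _, fun ω => ?_⟩
    obtain ⟨c, hc⟩ := exists_cocycle ω
    exact ⟨c, hc, Subsingleton.elim _ _⟩

/-! ### The Godbillon–Vey–Losik class -/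

/-- The form `gvl`. -/
def gvlForm : (S''modZ pt).closedForms 3 := (-1 : ℝ) • ⟨_, canon_mem_closed (Or.inr rfl)⟩

/-- The form `canon 3` pulls back to `-2` times the special cochain on `θ` and `θ_0 ∧ θ_1 ∧ θ_2` is
`2` times it, which explains the factor `-1` in `gvlForm`. -/
lemma isTheta012_gvlForm : IsTheta012 pt gvlForm.1 := by
  intro C z hz v
  change (-1 : ℝ) * pullback toS'' (family (canon 3) C) z v = _
  rw [pullback_toS''_family _ hz, pullback_toS''_canon_three hz.2, det_thetaK]
  ring

/-- The projection `S(U) → S''(U)` is a submersion. -/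
lemma exists_tangent_lift {z : RInf} (hz : z 1 ≠ 0) (w : RInf) :
    ∃ v : RInf, (fun n => lineDeriv ℝ (fun y => toS'' y n) z v) = w := by
  -- The tangent map is triangular: the component 1 determines `v 1`, and then each component `n +
  -- 2` is solved for `v (n + 2)`.
  let v : RInf
    | 0 => w 0
    | 1 => z 1 * w 1
    | n + 2 => z 1 ^ (n + 2) * w (n + 2) + (n + 2) * z (n + 2) * w 1
  refine ⟨v, ?_⟩
  obtain ⟨h0, h1, h2⟩ := lineDeriv_toS'' hz v
  funext n
  rcases n with _ | _ | n
  · exact h0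
  · refine h1.trans ?_
    change z 1 * w 1 / z 1 = w 1
    field_simp
  · refine (h2 n).trans ?_
    change (z 1 ^ (n + 2) * w (n + 2) + (n + 2) * z (n + 2) * w 1) / z 1 ^ (n + 2) -
      (n + 2) * z (n + 2) * (z 1 * w 1) / z 1 ^ (n + 3) = w (n + 2)
    field_simp
    ring

/-- Over every point of the domain the section `ofS''` provides a frame, where all tangent vectors
lift, so the pullback to frames determines the form. Outside the domain both forms are zero by
convention. -/
lemma isTheta012_unique {X : Type*} {A : D1Space X} {g g' : (S''modZ A).closedForms 3}
    (hg : IsTheta012 A g.1) (hg' : IsTheta012 A g'.1) : g = g' := by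
  refine Subtype.ext (funext fun c => funext fun x => funext fun w => ?_)
  by_cases hx : x ∈ (S''modZ A).dom c
  · have hz : ofS'' x ∈ frames c.1.U := ofS''_mem_frames hx
    choose v hv using fun a => exists_tangent_lift hz.2 (w a)
    have h := (hg c _ hz v).trans (hg' c _ hz v).symm
    have hv' : (fun a n => lineDeriv ℝ (fun y => toS'' y n) (ofS'' x) (v a)) = w := funext hv
    simp only [pullback, hv', toS''_ofS''] at h
    exact h
  · rw [(g.2.1.1 c).2 x hx, (g'.2.1.1 c).2 x hx]

/-- The pullback of `gvl` to a `𝒟_1`-space. -/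
def gvlPull {X : Type*} (A : D1Space X) : (S''modZ A).closedForms 3 :=
  ⟨pullPt A 3 gvlForm.1, pullPt_closed A gvlForm.2⟩

lemma isTheta012_gvlPull {X : Type*} (A : D1Space X) : IsTheta012 A (gvlPull A).1 :=
  fun c z hz v => isTheta012_gvlForm ⟨c.1.map fun _ => (), mem_univ _⟩ z hz v

/-- The form `1`. -/
def oneForm : (S''modZ pt).closedForms 0 := (1 : ℝ) • ⟨_, canon_mem_closed (Or.inl rfl)⟩

lemma isOne_oneForm : IsOne pt oneForm.1 := by
  intro C x hx v
  change (1 : ℝ) * family (canon 0) C x v = 1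
  rw [family_apply _ hx, one_mul]
  exact Matrix.det_fin_zero

end GVL

end

theorem mainTheorem9 :
    (∃ e : ∀ p : ℕ, (GVL.S''modZ GVL.pt).H p ≃ₗ[ℝ] GVL.HW1 p,
      ∀ (p : ℕ) (ω : (GVL.S''modZ GVL.pt).closedForms p), ∃ c : GVL.cocycles p,
        (∀ C, ∀ z ∈ GVL.frames C.1.U, ∀ v : Fin p → GVL.RInf,
          GVL.pullback GVL.toS'' (ω.1 C) z v = c.1 (fun a => GVL.theta z (v a))) ∧
        e p ((GVL.S''modZ GVL.pt).cls ω) = GVL.clsW1 c) ∧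
    (∀ p : ℕ, p ≠ 0 → p ≠ 3 → Subsingleton ((GVL.S''modZ GVL.pt).H p)) ∧
    (∃ one : (GVL.S''modZ GVL.pt).closedForms 0, GVL.IsOne GVL.pt one.1 ∧
      (GVL.S''modZ GVL.pt).cls one ≠ 0 ∧
      Submodule.span ℝ {(GVL.S''modZ GVL.pt).cls one} = ⊤) ∧
    ∃ gvl : (GVL.S''modZ GVL.pt).closedForms 3, GVL.IsTheta012 GVL.pt gvl.1 ∧
      (GVL.S''modZ GVL.pt).cls gvl ≠ 0 ∧
      Submodule.span ℝ {(GVL.S''modZ GVL.pt).cls gvl} = ⊤ ∧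
      ∀ (X : Type*) (A : GVL.D1Space X),
        (∃! g : (GVL.S''modZ A).closedForms 3, GVL.IsTheta012 A g.1) ∧
        ∀ g : (GVL.S''modZ A).closedForms 3, GVL.IsTheta012 A g.1 →
          GVL.charHom A 3 ((GVL.S''modZ GVL.pt).cls gvl) = (GVL.S''modZ A).cls g := by
  choose e he using GVL.exists_iso
  refine ⟨⟨e, he⟩, fun p h0 h3 => GVL.subsingleton_H h0 h3,
    ⟨GVL.oneForm, GVL.isOne_oneForm, GVL.cls_smul_canon_ne_zero (Or.inl rfl) one_ne_zero,
      GVL.span_cls_smul_canon (Or.inl rfl) one_ne_zero⟩,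
    GVL.gvlForm, GVL.isTheta012_gvlForm, GVL.cls_smul_canon_ne_zero (Or.inr rfl) (by norm_num),
    GVL.span_cls_smul_canon (Or.inr rfl) (by norm_num), fun X A => ⟨⟨GVL.gvlPull A, GVL.isTheta012_gvlPull A,
      fun g hg => GVL.isTheta012_unique hg (GVL.isTheta012_gvlPull A)⟩, fun g hg => ?_⟩⟩
  -- Uniqueness replaces `g` by the pullback of `gvl` from the point, whose class is the image under
  -- `charHom` by definition.
  rw [GVL.isTheta012_unique hg (GVL.isTheta012_gvlPull A)]
  rfl
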